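/- Theorem. A $k$-space is a compactly generated weakly Hausdorff space: a set $C\subseteq X$ is closed as soon as $u^{-1}(C)$ is closed for every continuous $u:K\to X$ with $K$ compact Hausdorff, and $u(K)$ is closed in $X$ for every such $u$. For a space $X$, $k(X)$ denotes $X$ with the topology whose closed sets are those $C$ with $u^{-1}(C)$ closed for every such $u$. Let $\mathbf U$ be the category of (small) $k$-spaces and continuous maps; it is cartesian monoidal, with product $X\times Y=k(X\times_{\mathrm{Top}}Y)$. A $k$-ring is a ring object in $\mathbf U$; for a $k$-ring $S$, let $S\text{-}\mathbf UMod$ be the category of left $S$-module objects in $\mathbf U$ and continuous $S$-linear maps. For $A,B\in S\text{-}\mathbf UMod$ let $\underline{\mathbf U_S}(A,B)$ be the set of morphisms $A\to B$ with the topology $k(\cdot)$ of the subspace topology coming from the space of continuous maps $A\to B$, which carries the coarsest compactly generated topology in which all sets $\{f: f(u(K))\subseteq U\}$ are open ($K$ compact Hausdorff, $u:K\to A$ continuous, $U\subseteq B$ open). Let $Q$ be a commutative $k$-ring and let $R$ be a $Q$-$k$-algebra, that is, a $k$-ring with a continuous ring homomorphism $Q\to R$ whose image is central. The tensor product $A\otimes_Q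 B$ of $A,B\in Q\text{-}\mathbf UMod$ is a $Q$-$k$-module with a continuous $Q$-bilinear map $A\times B\to A\otimes_Q B$, $(a,b)\mapsto a\otimes b$, through which every continuous $Q$-bilinear map from $A\times B$ to a $Q$-$k$-module factors uniquely by a morphism of $Q\text{-}\mathbf UMod$. Then: (i) Tensor products over $Q$ exist, and $Q\text{-}\mathbf UMod$ is a closed symmetric monoidal category under $\otimes_Q$, with unit $Q$, with the usual structure maps on elementary tensors ($(f\otimes g)(a\otimes b)=f(a)\otimes g(b)$, $(a\otimes b)\otimes c\mapsto a\otimes(b\otimes c)$, $q\otimes a\mapsto qa$, $a\otimes q\mapsto qa$, $a\otimes b\mapsto b\otimes a$), and with internal hom $\underline{\mathbf U_Q}(A,B)$, with its pointwise $Q$-module structure and evaluation $a\otimes h\mapsto h(a)$. (ii) The forgetful functors $Q\text{-}\mathbf UMod\to\mathbf U$ and $Q\text{-}\mathbf UMod\to Q\text{-}Mod$ (abstract modules over the underlying ring of $Q$, with the usual tensor product) have left adjoints $F:\mathbf U\to Q\text{-}\mathbf UMod$ and $G:Q\text{-}Mod\to Q\text{-}\mathbf UMod$, and $F$ and $G$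 are strong monoidal. Writing $\eta$ for the units of the adjunctions, the structure isomorphisms satisfy $\eta(x)\otimes\eta(y)\mapsto\eta(x,y)$ and $1\mapsto\eta(*)$ for $F$, and $\eta(a)\otimes\eta(b)\mapsto\eta(a\otimes b)$ and $1\mapsto\eta(1)$ for $G$. (iii) The category $R\text{-}\mathbf UMod$ is enriched, powered and copowered over $Q\text{-}\mathbf UMod$. The hom-objects are $\underline{\mathbf U_R}(A,B)$ with the pointwise $Q$-module structure, the enriched composition is induced by composition of morphisms, and the underlying ordinary category is $R\text{-}\mathbf UMod$. For all $A\in Q\text{-}\mathbf UMod$ and $B\in R\text{-}\mathbf UMod$ there are objects $A\pitchfork B$ and $A\odot B$ of $R\text{-}\mathbf UMod$ with isomorphisms of $Q$-$k$-modules $\underline{\mathbf U_R}(X,A\pitchfork B)\cong\underline{\mathbf U_Q}(A,\underline{\mathbf U_R}(X,B))$ and $\underline{\mathbf U_R}(A\odot B,X)\cong\underline{\mathbf U_Q}(A,\underline{\mathbf U_R}(B,X))$, natural in $X\in R\text{-}\mathbf UMod$ in the sense enriched over $Q\text{-}\mathbf UMod$. -/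

import Mathlib

open CategoryTheory MonoidalCategory Limits
open scoped TensorProduct

universe u

/-! ### Compactly generated weakly Hausdorff spaces -/

/-- A space is weakly Hausdorff if every continuous image of a compact Hausdorff space in it
is closed. -/
class WeaklyHausdorffSpace (X : Type u) [TopologicalSpace X] : Prop where
  isClosed_range : ∀ (K : CompHaus.{u}) (v : C(K, X)), IsClosed (Set.range v)

/-- Joint continuity of `f : X × Y → Z` for the `k`-product, that is, for the compactly generated
topology associated with the product topology. -/
def KContinuous₂ {X Y Z : Type u} [TopologicalSpace X] [TopologicalSpace Y] [tZ : TopologicalSpace Z]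
    (f : X → Y → Z) : Prop :=
  @Continuous (X × Y) Z (TopologicalSpace.compactlyGenerated.{u} (X × Y)) tZ
    (fun p => f p.1 p.2)

section Kification

variable {X Y Z : Type u}

theorem compactlyGenerated_le [t : TopologicalSpace X] :
    TopologicalSpace.compactlyGenerated.{u} X ≤ t := by
  have h : @Continuous X X (TopologicalSpace.compactlyGenerated.{u} X) t id :=
    continuous_from_compactlyGenerated id (fun S g => by simpa using g.continuous)
  exact continuous_id_iff_le.mp h

/-- Maps from compact Hausdorff spaces see no difference between a space and its
`k`-ification. -/
theorem continuous_to_compactlyGenerated [t : TopologicalSpace X] (K : CompHaus.{u})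
    (g : K → X) (hg : Continuous g) :
    @Continuous K X _ (TopologicalSpace.compactlyGenerated.{u} X) g := by
  rw [continuous_def]
  intro U hU
  rw [TopologicalSpace.compactlyGenerated, isOpen_coinduced, isOpen_sigma_iff] at hU
  exact hU ⟨K, ⟨g, hg⟩⟩

theorem compactlyGeneratedSpace_kification [t : TopologicalSpace X] :
    @CompactlyGeneratedSpace X (TopologicalSpace.compactlyGenerated.{u} X) :=
  @uCompactlyGeneratedSpace_of_isClosed.{u} X (TopologicalSpace.compactlyGenerated.{u} X)
    (fun s h => by
      rw [TopologicalSpace.compactlyGenerated, isClosed_coinduced, isClosed_sigma_iff]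
      rintro ⟨S, f⟩
      exact h S (@ContinuousMap.mk _ _ _ (TopologicalSpace.compactlyGenerated.{u} X) f
        (continuous_to_compactlyGenerated S f f.2)))

theorem weaklyHausdorffSpace_of_le {t t' : TopologicalSpace X} (h : t' ≤ t)
    (hX : @WeaklyHausdorffSpace X t) : @WeaklyHausdorffSpace X t' :=
  @WeaklyHausdorffSpace.mk X t' (fun K v =>
    IsClosed.mono (@WeaklyHausdorffSpace.isClosed_range X t hX K
      (@ContinuousMap.mk K X _ t v
        (continuous_le_rng h (@ContinuousMap.continuous K X _ t' v)))) h)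

variable [TopologicalSpace X] [TopologicalSpace Y]

theorem WeaklyHausdorffSpace.isClosed_singleton [WeaklyHausdorffSpace X] (x : X) :
    IsClosed ({x} : Set X) := by
  have := WeaklyHausdorffSpace.isClosed_range (X := X) (CompHaus.of PUnit.{u + 1})
    (ContinuousMap.const _ x)
  have h : Set.range (ContinuousMap.const (CompHaus.of PUnit.{u + 1}) x) = {x} := by
    ext y
    constructor
    · rintro ⟨_, rfl⟩
      rfl
    · rintro rfl
      exact ⟨PUnit.unit, rfl⟩
  rwa [h] at this

theorem WeaklyHausdorffSpace.isClosed_image [WeaklyHausdorffSpace X] (K : CompHaus.{u})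
    (v : C(K, X)) (s : Set K) (hs : IsClosed s) : IsClosed (v '' s) := by
  have : CompactSpace s := isCompact_iff_compactSpace.mp hs.isCompact
  have := WeaklyHausdorffSpace.isClosed_range (X := X) (CompHaus.of s)
    ⟨fun k => v k.1, v.continuous.comp continuous_subtype_val⟩
  convert this using 1
  ext x
  constructor
  · rintro ⟨k, hk, rfl⟩
    exact ⟨⟨k, hk⟩, rfl⟩
  · rintro ⟨k, rfl⟩
    exact ⟨k.1, k.2, rfl⟩

/-- In a weakly Hausdorff space the image of a compact Hausdorff space is Hausdorff. -/
theorem WeaklyHausdorffSpace.t2Space_range [WeaklyHausdorffSpace X] (K : CompHaus.{u})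
    (v : C(K, X)) : T2Space (Set.range v) := by
  refine ⟨?_⟩
  rintro ⟨x, hx⟩ ⟨y, hy⟩ hxy
  have hxy' : x ≠ y := fun h => hxy (Subtype.ext h)
  have hd : Disjoint (v ⁻¹' {x}) (v ⁻¹' {y}) := by
    rw [Set.disjoint_left]
    intro k hk hk'
    exact hxy' ((Set.mem_singleton_iff.mp hk).symm.trans (Set.mem_singleton_iff.mp hk'))
  have : T2Space K := K.is_hausdorff
  have : R1Space K := T2Space.r1Space
  have : NormalSpace K := NormalSpace.of_compactSpace_r1Space
  obtain ⟨U, V, hU, hV, hxU, hyV, hUV⟩ := normal_separation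
    ((WeaklyHausdorffSpace.isClosed_singleton x).preimage v.continuous)
    ((WeaklyHausdorffSpace.isClosed_singleton y).preimage v.continuous) hd
  have hcU := WeaklyHausdorffSpace.isClosed_image K v Uᶜ hU.isClosed_compl
  have hcV := WeaklyHausdorffSpace.isClosed_image K v Vᶜ hV.isClosed_compl
  refine ⟨Subtype.val ⁻¹' (v '' Uᶜ)ᶜ, Subtype.val ⁻¹' (v '' Vᶜ)ᶜ,
    hcU.isOpen_compl.preimage continuous_subtype_val,
    hcV.isOpen_compl.preimage continuous_subtype_val, ?_, ?_, ?_⟩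
  · rintro ⟨k, hk, hkx⟩
    exact hk (hxU hkx)
  · rintro ⟨k, hk, hky⟩
    exact hk (hyV hky)
  · rw [Set.disjoint_left]
    rintro ⟨_, ⟨k, rfl⟩⟩ h1 h2
    have hkU : k ∈ U := by
      by_contra h
      exact h1 ⟨k, h, rfl⟩
    have hkV : k ∈ V := by
      by_contra h
      exact h2 ⟨k, h, rfl⟩
    exact Set.disjoint_left.mp hUV hkU hkV

instance WeaklyHausdorffSpace.prod [WeaklyHausdorffSpace X] [WeaklyHausdorffSpace Y] :
    WeaklyHausdorffSpace (X × Y) := by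
  refine ⟨fun K v => ?_⟩
  let v₁ : C(K, X) := ⟨fun k => (v k).1, continuous_fst.comp v.continuous⟩
  let v₂ : C(K, Y) := ⟨fun k => (v k).2, continuous_snd.comp v.continuous⟩
  have := WeaklyHausdorffSpace.t2Space_range K v₁
  have := WeaklyHausdorffSpace.t2Space_range K v₂
  let w : K → Set.range v₁ × Set.range v₂ := fun k => (⟨v₁ k, k, rfl⟩, ⟨v₂ k, k, rfl⟩)
  have hw : Continuous w := by
    refine Continuous.prodMk ?_ ?_
    · exact v₁.continuous.subtype_mk _
    · exact v₂.continuous.subtype_mk _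
  have hc : IsClosed (Set.range w) := (isCompact_range hw).isClosed
  have he : Topology.IsClosedEmbedding
      (Prod.map Subtype.val Subtype.val : Set.range v₁ × Set.range v₂ → X × Y) :=
    ((WeaklyHausdorffSpace.isClosed_range K v₁).isClosedEmbedding_subtypeVal).prodMap
      ((WeaklyHausdorffSpace.isClosed_range K v₂).isClosedEmbedding_subtypeVal)
  have := he.isClosedMap _ hc
  rw [← Set.range_comp] at this
  exact this

end Kification

/-- A `k`-space: a compactly generated weakly Hausdorff space. -/
structure KSpace : Type (u + 1) where
  carrier : Type u
  [topology : TopologicalSpace carrier]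
  [compactlyGenerated : CompactlyGeneratedSpace carrier]
  [weaklyHausdorff : WeaklyHausdorffSpace carrier]

namespace KSpace

instance : CoeSort KSpace.{u} (Type u) := ⟨KSpace.carrier⟩

attribute [instance] topology compactlyGenerated weaklyHausdorff

/-- The category of `k`-spaces and continuous maps. -/
instance : Category.{u} KSpace.{u} where
  Hom X Y := C(X, Y)
  id X := ContinuousMap.id X
  comp f g := ContinuousMap.comp g f

instance : ConcreteCategory KSpace.{u} (fun X Y => C(X, Y)) where
  hom f := f
  ofHom f := f

/-- The product of `k`-spaces: the cartesian product with the compactly generated topology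
associated with the product topology. -/
def prod (X Y : KSpace.{u}) : KSpace.{u} :=
  @KSpace.mk (X × Y) (TopologicalSpace.compactlyGenerated.{u} (X × Y))
    compactlyGeneratedSpace_kification
    (weaklyHausdorffSpace_of_le compactlyGenerated_le inferInstance)

/-- The one-point `k`-space. -/
def point : KSpace.{u} :=
  haveI : WeaklyHausdorffSpace PUnit.{u + 1} := ⟨fun _ _ => isClosed_discrete _⟩
  ⟨PUnit.{u + 1}⟩

/-- The first projection of the product of `k`-spaces. -/
def prodFst (X Y : KSpace.{u}) : prod X Y ⟶ X :=
  @ContinuousMap.mk (X × Y) X (TopologicalSpace.compactlyGenerated.{u} (X × Y)) _ Prod.fst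
    (continuous_le_dom compactlyGenerated_le continuous_fst)

/-- The second projection of the product of `k`-spaces. -/
def prodSnd (X Y : KSpace.{u}) : prod X Y ⟶ Y :=
  @ContinuousMap.mk (X × Y) Y (TopologicalSpace.compactlyGenerated.{u} (X × Y)) _ Prod.snd
    (continuous_le_dom compactlyGenerated_le continuous_snd)

/-- The map into a product of `k`-spaces with given components. -/
def prodLift {W X Y : KSpace.{u}} (f : W ⟶ X) (g : W ⟶ Y) : W ⟶ prod X Y :=
  @ContinuousMap.mk W (X × Y) _ (TopologicalSpace.compactlyGenerated.{u} (X × Y))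
    (fun w => (f w, g w)) (by
      refine @continuous_from_uCompactlyGeneratedSpace.{u} W (X × Y) _
        (TopologicalSpace.compactlyGenerated.{u} (X × Y)) _ _ (fun S h => ?_)
      refine continuous_to_compactlyGenerated S _ ?_
      exact ((ContinuousMap.continuous (X := W) (Y := X) f).comp h.continuous).prodMk
        ((ContinuousMap.continuous (X := W) (Y := Y) g).comp h.continuous))

/-- The product of `k`-spaces is their categorical product. -/
def prodIsLimit (X Y : KSpace.{u}) : IsLimit (BinaryFan.mk (prodFst X Y) (prodSnd X Y)) :=
  BinaryFan.isLimitMk (fun s => prodLift s.fst s.snd) (fun _ => rfl) (fun _ => rfl)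
    (fun s m h₁ h₂ => by
      apply ConcreteCategory.hom_ext
      intro w
      exact Prod.ext (ConcreteCategory.congr_hom h₁ w) (ConcreteCategory.congr_hom h₂ w))

/-- The one-point `k`-space is terminal. -/
def pointIsTerminal : IsTerminal point.{u} :=
  IsTerminal.ofUniqueHom (fun X => (ContinuousMap.const X PUnit.unit : C(X, PUnit.{u + 1})))
    (fun _ _ => ConcreteCategory.hom_ext _ _ (fun _ => rfl))

/-- The cartesian monoidal structure on the category of `k`-spaces. -/
instance : CartesianMonoidalCategory KSpace.{u} :=
  CartesianMonoidalCategory.ofChosenFiniteProducts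
    ⟨asEmptyCone point, pointIsTerminal⟩
    (fun X Y => ⟨BinaryFan.mk (prodFst X Y) (prodSnd X Y), prodIsLimit X Y⟩)

end KSpace

/-! ### `k`-rings and `k`-modules -/

/-- A `k`-ring: a ring object in the category of `k`-spaces. -/
class IsKRing (R : Type u) [Ring R] [TopologicalSpace R] : Prop where
  compactlyGenerated : CompactlyGeneratedSpace R
  weaklyHausdorff : WeaklyHausdorffSpace R
  continuous_add : KContinuous₂ (fun a b : R => a + b)
  continuous_neg : Continuous (fun a : R => -a)
  continuous_mul : KContinuous₂ (fun a b : R => a * b)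

/-- An `R`-`k`-module: a left `R`-module object in the category of `k`-spaces. -/
structure KMod (R : Type u) [Ring R] [TopologicalSpace R] : Type (u + 1) where
  carrier : Type u
  [addCommGroup : AddCommGroup carrier]
  [module : Module R carrier]
  [topology : TopologicalSpace carrier]
  [compactlyGenerated : CompactlyGeneratedSpace carrier]
  [weaklyHausdorff : WeaklyHausdorffSpace carrier]
  continuous_add : KContinuous₂ (fun a b : carrier => a + b)
  continuous_neg : Continuous (fun a : carrier => -a)
  continuous_smul : KContinuous₂ (fun (r : R) (a : carrier) => r • a)

namespace KMod

section

variable {R : Type u} [Ring R] [TopologicalSpace R]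

instance : CoeSort (KMod.{u} R) (Type u) := ⟨KMod.carrier⟩

attribute [instance] addCommGroup module topology compactlyGenerated weaklyHausdorff

/-- The category of `R`-`k`-modules and continuous `R`-linear maps. -/
instance : Category.{u} (KMod.{u} R) where
  Hom A B := A →L[R] B
  id A := ContinuousLinearMap.id R A
  comp f g := ContinuousLinearMap.comp g f

instance : ConcreteCategory (KMod.{u} R) (fun A B => A →L[R] B) where
  hom f := f
  ofHom f := f

variable (R)

/-- The forgetful functor from `R`-`k`-modules to `k`-spaces. -/
def forgetToKSpace : KMod.{u} R ⥤ KSpace.{u} where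
  obj A := ⟨A⟩
  map {A B} f := ⟨(f : A →L[R] B), (f : A →L[R] B).continuous⟩

/-- The forgetful functor from `R`-`k`-modules to abstract `R`-modules. -/
def forgetToModuleCat : KMod.{u} R ⥤ ModuleCat.{u} R where
  obj A := ModuleCat.of R A
  map {A B} f := ModuleCat.ofHom (ContinuousLinearMap.toLinearMap (f : A →L[R] B))

/-- A `k`-ring as a module over itself. -/
def self [IsKRing R] : KMod.{u} R :=
  haveI := IsKRing.compactlyGenerated (R := R)
  haveI := IsKRing.weaklyHausdorff (R := R)
  { carrier := R
    continuous_add := IsKRing.continuous_add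
    continuous_neg := IsKRing.continuous_neg
    continuous_smul := IsKRing.continuous_mul }

end

section Tensor

variable {Q : Type u} [CommRing Q] [TopologicalSpace Q]

/-- Continuous `Q`-bilinear maps `A × B → C`, where `A × B` is the product of `k`-spaces. -/
structure IsKBilinear {A B C : KMod.{u} Q} (f : A → B → C) : Prop where
  map_add_left : ∀ a a' b, f (a + a') b = f a b + f a' b
  map_add_right : ∀ a b b', f a (b + b') = f a b + f a b'
  map_smul_left : ∀ (q : Q) a b, f (q • a) b = q • f a b
  map_smul_right : ∀ (q : Q) a b, f a (q • b) = q • f a b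
  continuous : KContinuous₂ f

/-- `T`, with the bilinear map `t`, is a tensor product of the `Q`-`k`-modules `A` and `B`. -/
structure IsTensorProduct {A B T : KMod.{u} Q} (t : A → B → T) : Prop where
  isKBilinear : IsKBilinear t
  existsUnique : ∀ (C : KMod.{u} Q) (f : A → B → C), IsKBilinear f →
    ∃! g : T ⟶ C, ∀ a b, g (t a b) = f a b

variable (Q) in
/-- A symmetric monoidal structure on the category of `Q`-`k`-modules is the one given by `⊗_Q`:
its tensor products are tensor products of `Q`-`k`-modules, its unit is `Q`, and all the structure
maps are the usual ones on elementary tensors. -/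
structure TensorStructure [IsKRing Q] [MonoidalCategory (KMod.{u} Q)]
    [BraidedCategory (KMod.{u} Q)] where
  tmul : ∀ {A B : KMod.{u} Q}, A → B → (A ⊗ B : KMod.{u} Q)
  isTensorProduct : ∀ A B : KMod.{u} Q, IsTensorProduct (tmul (A := A) (B := B))
  unitIso : self Q ≅ 𝟙_ (KMod.{u} Q)
  tensorHom_tmul : ∀ {A A' B B' : KMod.{u} Q} (f : A ⟶ A') (g : B ⟶ B') (a : A) (b : B),
    (f ⊗ₘ g) (tmul a b) = tmul (f a) (g b)
  associator_tmul : ∀ {A B C : KMod.{u} Q} (a : A) (b : B) (c : C),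
    (α_ A B C).hom (tmul (tmul a b) c) = tmul a (tmul b c)
  leftUnitor_tmul : ∀ {A : KMod.{u} Q} (q : Q) (a : A),
    (λ_ A).hom (tmul (unitIso.hom (show self Q from q)) a) = q • a
  rightUnitor_tmul : ∀ {A : KMod.{u} Q} (q : Q) (a : A),
    (ρ_ A).hom (tmul a (unitIso.hom (show self Q from q))) = q • a
  braiding_tmul : ∀ {A B : KMod.{u} Q} (a : A) (b : B),
    (β_ A B).hom (tmul a b) = tmul b a

/-- The element `1` of the unit object. -/
def TensorStructure.one [IsKRing Q] [MonoidalCategory (KMod.{u} Q)]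
    [BraidedCategory (KMod.{u} Q)] (T : TensorStructure Q) : (𝟙_ (KMod.{u} Q) : KMod.{u} Q) :=
  T.unitIso.hom (show self Q from (1 : Q))

end Tensor

end KMod

/-! ### Spaces and modules of maps -/

/-- The `k`-compact-open topology on `C(X, Y)`: the coarsest compactly generated topology for which
the sets `{f | f (v K) ⊆ U}` are open, for `v : K → X` continuous with `K` compact Hausdorff and
`U` open in `Y`. -/
@[reducible]
def kCompactOpen (X Y : Type u) [TopologicalSpace X] [TopologicalSpace Y] :
    TopologicalSpace C(X, Y) :=
  @TopologicalSpace.compactlyGenerated.{u} C(X, Y) (TopologicalSpace.generateFrom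
    {S | ∃ (K : CompHaus.{u}) (v : C(K, X)) (U : Set Y), IsOpen U ∧
      S = {f : C(X, Y) | ∀ k, f (v k) ∈ U}})

namespace KMod

variable {Q R : Type u} [CommRing Q] [TopologicalSpace Q]
  [Ring R] [TopologicalSpace R] [Algebra Q R]

/-- The bijection `e` identifies the `Q`-`k`-module `H` with the set of morphisms `A ⟶ B` of
`R`-`k`-modules, carrying the pointwise `Q`-module structure and the `k`-subspace topology of the
`k`-compact-open topology. -/
structure IsHomModule {A B : KMod.{u} R} {H : KMod.{u} Q} (e : H ≃ (A ⟶ B)) : Prop where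
  add_apply : ∀ (h h' : H) (a : A), e (h + h') a = e h a + e h' a
  smul_apply : ∀ (q : Q) (h : H) (a : A), e (q • h) a = algebraMap Q R q • e h a
  topology_eq : H.topology = @TopologicalSpace.compactlyGenerated.{u} H
    (TopologicalSpace.induced
      (fun h => (⟨(e h : A →L[R] B), (e h : A →L[R] B).continuous⟩ : C(A, B))) (kCompactOpen A B))

end KMod

/-! ### Powers and copowers in an enriched category -/

namespace EnrichedPower

variable {V : Type*} [Category V] [MonoidalCategory V] [SymmetricCategory V] [MonoidalClosed V]
  {C : Type*} [EnrichedCategory V C]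

/-- For `j : A ⟶ C(B, P)`, the map `C(P, X) ⟶ [A, C(B, X)]` induced by `j` and composition. -/
def copowerComparison {A : V} {B P : C} (j : A ⟶ EnrichedCategory.Hom B P) (X : C) :
    (EnrichedCategory.Hom P X : V) ⟶ (ihom A).obj (EnrichedCategory.Hom B X) :=
  MonoidalClosed.curry (j ▷ EnrichedCategory.Hom P X ≫ eComp V B P X)

/-- For `j : A ⟶ C(P, B)`, the map `C(X, P) ⟶ [A, C(X, B)]` induced by `j` and composition. -/
def powerComparison {A : V} {B P : C} (j : A ⟶ EnrichedCategory.Hom P B) (X : C) :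
    (EnrichedCategory.Hom X P : V) ⟶ (ihom A).obj (EnrichedCategory.Hom X B) :=
  MonoidalClosed.curry ((β_ A (EnrichedCategory.Hom X P)).hom ≫
    EnrichedCategory.Hom X P ◁ j ≫ eComp V X P B)

variable (V C)

/-- `C` is copowered (tensored) over `V`: for all `A : V` and `B : C` there is an object `A ⊙ B`
with `C(A ⊙ B, X) ≅ [A, C(B, X)]`, `V`-naturally in `X`. By the enriched Yoneda lemma such an
isomorphism is induced by its unit `A ⟶ C(B, A ⊙ B)`. -/
def Copowered : Prop :=
  ∀ (A : V) (B : C), ∃ (P : C) (j : A ⟶ EnrichedCategory.Hom B P),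
    ∀ X : C, IsIso (copowerComparison j X)

/-- `C` is powered (cotensored) over `V`: for all `A : V` and `B : C` there is an object `A ⋔ B`
with `C(X, A ⋔ B) ≅ [A, C(X, B)]`, `V`-naturally in `X`. By the enriched Yoneda lemma such an
isomorphism is induced by its counit `A ⟶ C(A ⋔ B, B)`. -/
def Powered : Prop :=
  ∀ (A : V) (B : C), ∃ (P : C) (j : A ⟶ EnrichedCategory.Hom P B),
    ∀ X : C, IsIso (powerComparison j X)

end EnrichedPower

/-! Everything is tested on continuous maps from compact Hausdorff spaces. Passing from a topology
to its `k`-ification does not change these test maps, so joint `k`-continuity of `f` means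
continuity of `f (a k) (b k)` for all pairs of test maps `a`, `b` on a common source
(`kContinuous₂_iff`). For a compactly generated space, weak Hausdorffness means that two test maps
agree on a closed set, a condition which passes to any topology defined by a point-separating family
of maps to such spaces.

Two constructions carry the theorem. The first is the module of maps `funMod`, with its exponential
law: a map from a compactly generated space into it is continuous iff the uncurried map is jointly
`k`-continuous (`continuous_funMod_iff`). This rests on the good behaviour of the compact-open
topology on `C(L, Y)` for compact `L`. Hom-modules and powers are instances.

The second is `reflect`: for an abstract module `M` and a map `t` from a `k`-space to `M`, the
universal `k`-module under `M` in which `t` becomes continuous. It is the quotient of `M` by the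
common kernel of all linear maps to `k`-modules making `t` continuous, with the `k`-ified initial
topology of these maps. Tensor products and copowers take `t` to be the elementary tensors, `F` the
basis elements, and `G` the zero map from a point, which imposes no condition.

The universal property of `reflect` is itself compatible with parameters (`kContinuous₂_reflect`): a
family of morphisms depending on `w : W` is transposed to a single linear map into the `k`-module of
continuous maps on `W`, and that map factors through `reflect`. Hence the inverse of the copower
comparison is continuous, and continuous maps on `X × Y` extend to the tensor product of the free
modules. Coherence laws are then checked on generators. -/

/-! ### Compactly generated topologies and test maps -/

section TestMaps

variable {W X Y Z : Type u} [TopologicalSpace W] [TopologicalSpace X] [TopologicalSpace Y]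
  [TopologicalSpace Z]

theorem continuous_to_compactlyGenerated_iff {K : Type u} [TopologicalSpace K] [CompactSpace K]
    [T2Space K] {X : Type u} {t : TopologicalSpace X} {g : K → X} :
    @Continuous K X _ (@TopologicalSpace.compactlyGenerated.{u} X t) g ↔ Continuous g :=
  ⟨fun h => continuous_le_rng compactlyGenerated_le h,
    fun h => continuous_to_compactlyGenerated (CompHaus.of K) g h⟩

/-- A test map into the `k`-product is just a pair of test maps into the factors. -/
theorem kContinuous₂_iff {f : X → Y → Z} :
    KContinuous₂ f ↔ ∀ (K : CompHaus.{u}) (a : C(K, X)) (b : C(K, Y)),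
      Continuous fun k => f (a k) (b k) := by
  constructor
  · intro h K a b
    exact @Continuous.comp K (X × Y) Z _ (TopologicalSpace.compactlyGenerated.{u} (X × Y)) _ _ _ h
      (continuous_to_compactlyGenerated K (fun k => (a k, b k))
        (a.continuous.prodMk b.continuous))
  · intro h
    exact continuous_from_compactlyGenerated _ (fun K g =>
      h K ⟨fun k => (g k).1, by fun_prop⟩ ⟨fun k => (g k).2, by fun_prop⟩)

theorem compactlyGeneratedSpace_of_compactSpace [CompactSpace X] [T2Space X] :
    CompactlyGeneratedSpace X :=
  uCompactlyGeneratedSpace_of_isClosed fun _ h => h (CompHaus.of X) (.id X)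

instance (K : CompHaus.{u}) : CompactlyGeneratedSpace K :=
  compactlyGeneratedSpace_of_compactSpace

instance (K L : CompHaus.{u}) : CompactlyGeneratedSpace (K × L) :=
  compactlyGeneratedSpace_of_compactSpace

theorem continuous_of_comp_compHaus [CompactlyGeneratedSpace X] {f : X → Y}
    (h : ∀ (K : CompHaus.{u}) (a : C(K, X)), Continuous fun k => f (a k)) : Continuous f :=
  continuous_from_uCompactlyGeneratedSpace f h

theorem KContinuous₂.comp [CompactlyGeneratedSpace W] {f : X → Y → Z} (hf : KContinuous₂ f)
    {a : W → X} {b : W → Y} (ha : Continuous a) (hb : Continuous b) :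
    Continuous fun w => f (a w) (b w) :=
  continuous_of_comp_compHaus fun K g =>
    kContinuous₂_iff.mp hf K ⟨fun k => a (g k), by fun_prop⟩ ⟨fun k => b (g k), by fun_prop⟩

theorem KContinuous₂.swap {f : X → Y → Z} (hf : KContinuous₂ f) :
    KContinuous₂ fun y x => f x y :=
  kContinuous₂_iff.mpr fun K a b => kContinuous₂_iff.mp hf K b a

theorem KContinuous₂.comp₂ {X' Y' Z' : Type u} [TopologicalSpace X'] [TopologicalSpace Y']
    [TopologicalSpace Z'] {f : X → Y → Z} (hf : KContinuous₂ f)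
    {a : X' → X} {b : Y' → Y} {c : Z → Z'} (ha : Continuous a) (hb : Continuous b)
    (hc : Continuous c) : KContinuous₂ fun x y => c (f (a x) (b y)) :=
  kContinuous₂_iff.mpr fun K g h =>
    hc.comp (kContinuous₂_iff.mp hf K ⟨fun k => a (g k), by fun_prop⟩
      ⟨fun k => b (h k), by fun_prop⟩)

/-- Both maps factor through the image of the single test map `Sum.elim a b` on `K ⊕ K`, and that
image is Hausdorff although `X` need not be. -/
theorem WeaklyHausdorffSpace.isClosed_eq [WeaklyHausdorffSpace X] {K : Type u}
    [TopologicalSpace K] [CompactSpace K] [T2Space K] {a b : K → X} (ha : Continuous a)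
    (hb : Continuous b) : IsClosed {k | a k = b k} := by
  let v : C(CompHaus.of (K ⊕ K), X) := ⟨Sum.elim a b, ha.sumElim hb⟩
  have := WeaklyHausdorffSpace.t2Space_range _ v
  let a' : K → Set.range v := fun k => ⟨a k, Sum.inl k, rfl⟩
  let b' : K → Set.range v := fun k => ⟨b k, Sum.inr k, rfl⟩
  have ha' : Continuous a' := ha.subtype_mk _
  have hb' : Continuous b' := hb.subtype_mk _
  have h := _root_.isClosed_eq ha' hb'
  convert h using 1
  ext k
  exact (Subtype.ext_iff (a1 := a' k) (a2 := b' k)).symm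

/-- The preimage of `range v` under a test map `w` is the projection to `L` of the fibre product of
`w` and `v`. The fibre product is an equalizer on `L × K`, and projecting along the compact space
`K` is a closed map. -/
theorem weaklyHausdorffSpace_of_isClosed_eq [CompactlyGeneratedSpace X]
    (h : ∀ (K : CompHaus.{u}) (a b : C(K, X)), IsClosed {k | a k = b k}) :
    WeaklyHausdorffSpace X := by
  refine ⟨fun K v => UCompactlyGeneratedSpace.isClosed.{u} fun L w => ?_⟩
  have hc := h (CompHaus.of (L × K)) ⟨fun p => w p.1, by fun_prop⟩ ⟨fun p => v p.2, by fun_prop⟩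
  have := isClosedMap_fst_of_compactSpace (X := L) (Y := K) _ hc
  convert this using 1
  ext l
  constructor
  · rintro ⟨k, hk⟩
    exact ⟨(l, k), hk.symm, rfl⟩
  · rintro ⟨⟨_, k⟩, hk, rfl⟩
    exact ⟨k, hk.symm⟩

theorem continuous_uncurry_of_compactSpace [CompactSpace X] [T2Space X] (g : C(W, C(X, Y))) :
    Continuous fun p : W × X => g p.1 p.2 :=
  ContinuousMap.continuous_uncurry_of_continuous g

/-- Restriction along `v : L → X` lands in `C(L, Y)`, where currying and uncurrying preserve
continuity because `L` is compact Hausdorff. -/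
theorem continuous_kCompactOpen_iff {K : Type u} [TopologicalSpace K] [CompactSpace K]
    [T2Space K] {g : K → C(X, Y)} :
    @Continuous K C(X, Y) _ (kCompactOpen X Y) g ↔
      ∀ (L : CompHaus.{u}) (v : C(L, X)), Continuous fun p : K × L => g p.1 (v p.2) := by
  rw [continuous_to_compactlyGenerated_iff, continuous_generateFrom_iff]
  constructor
  · intro h L v
    let G : K → C(L, Y) := fun k => (g k).comp v
    have hG : Continuous G := by
      refine ContinuousMap.continuous_compactOpen.mpr fun C hC U hU => ?_
      -- A compact subset of `L` is again a test space, so a subbasic open set of `C(L, Y)` pulls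
      -- back to a generating open set on `C(X, Y)`.
      have : CompactSpace C := isCompact_iff_compactSpace.mp hC
      convert h _ ⟨CompHaus.of C, ⟨fun c => v c.1, by fun_prop⟩, U, hU, rfl⟩ using 1
      ext k
      exact ⟨fun hk c => hk c.2, fun hk c hc => hk ⟨c, hc⟩⟩
    exact continuous_uncurry_of_compactSpace ⟨G, hG⟩
  · rintro h _ ⟨L, v, U, hU, rfl⟩
    let G : C(K, C(L, Y)) := ContinuousMap.curry ⟨fun p : K × L => g p.1 (v p.2), h L v⟩
    convert (ContinuousMap.isOpen_setOfPred_mapsTo (isCompact_univ (X := L)) hU).preimage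
      G.continuous using 1
    ext k
    exact ⟨fun hk l _ => hk l, fun hk l => hk (Set.mem_univ l)⟩

end TestMaps

/-! ### Building `k`-modules and their isomorphisms -/

namespace KMod

section Constructions

variable {R : Type u} [Ring R] [TopologicalSpace R]

/-- The morphism of `R`-`k`-modules given by a continuous linear map. -/
def mkHom {A B : KMod.{u} R} (f : A →ₗ[R] B) (hf : Continuous f) : A ⟶ B :=
  (⟨f, hf⟩ : A →L[R] B)

theorem continuous_hom {A B : KMod.{u} R} (f : A ⟶ B) : Continuous fun a => f a :=
  ContinuousLinearMap.continuous (f : A →L[R] B)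

/-- The linear map underlying a morphism of `R`-`k`-modules. -/
def toLin {A B : KMod.{u} R} (f : A ⟶ B) : A →ₗ[R] B :=
  ContinuousLinearMap.toLinearMap (f : A →L[R] B)

@[simp]
theorem toLin_apply {A B : KMod.{u} R} (f : A ⟶ B) (a : A) : toLin f a = f a := rfl

@[ext]
theorem hom_ext {A B : KMod.{u} R} {f g : A ⟶ B} (h : ∀ a, f a = g a) : f = g :=
  ConcreteCategory.hom_ext _ _ h

/-- The isomorphism given by a morphism with a continuous set-theoretic inverse. -/
def isoOfInverse {A B : KMod.{u} R} (f : A ⟶ B) (g : B → A) (hg : Continuous g)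
    (hgf : ∀ a, g (f a) = a) (hfg : ∀ b, f (g b) = b) : A ≅ B where
  hom := f
  inv := mkHom
    { toFun := g
      map_add' := fun b b' => by
        rw [← hgf (g b + g b'), ← toLin_apply f, map_add, toLin_apply, toLin_apply, hfg, hfg]
      map_smul' := fun r b => by
        rw [RingHom.id_apply, ← hgf (r • g b), ← toLin_apply f, map_smul, toLin_apply, hfg] } hg
  hom_inv_id := hom_ext hgf
  inv_hom_id := hom_ext hfg

section OfTopology

variable (M : Type u) [AddCommGroup M] [Module R M] (t : TopologicalSpace M)
  (hadd : ∀ (K : CompHaus.{u}) (a b : C(K, M)), Continuous fun k => a k + b k)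
  (hsmul : ∀ (K : CompHaus.{u}) (r : C(K, R)) (a : C(K, M)), Continuous fun k => r k • a k)
  (hsep : ∀ (K : CompHaus.{u}) (a b : C(K, M)), IsClosed {k | a k = b k})

/-- The `R`-`k`-module given by the `k`-ification of a topology for which the operations are
continuous along test maps. -/
def ofTopology : KMod.{u} R :=
  letI τ := @TopologicalSpace.compactlyGenerated.{u} M t
  haveI : @CompactlyGeneratedSpace M τ := @compactlyGeneratedSpace_kification M t
  have test : ∀ {K : CompHaus.{u}} {g : K → M}, @Continuous K M _ τ g → @Continuous K M _ t g :=
    fun h => continuous_to_compactlyGenerated_iff.mp h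
  have test' : ∀ {K : CompHaus.{u}} {g : K → M}, @Continuous K M _ t g → @Continuous K M _ τ g :=
    fun h => continuous_to_compactlyGenerated_iff.mpr h
  { carrier := M
    topology := τ
    weaklyHausdorff := weaklyHausdorffSpace_of_isClosed_eq fun K a b =>
      hsep K (@ContinuousMap.mk K M _ t a (test a.2)) (@ContinuousMap.mk K M _ t b (test b.2))
    continuous_add := kContinuous₂_iff.mpr fun K a b => test' <|
      hadd K (@ContinuousMap.mk K M _ t a (test a.2)) (@ContinuousMap.mk K M _ t b (test b.2))
    -- Negation is scalar multiplication by the constant `-1`, so `hsmul` covers it.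
    continuous_neg := continuous_of_comp_compHaus fun K a => test' <| by
      simpa using hsmul K (.const K (-1)) (@ContinuousMap.mk K M _ t a (test a.2))
    continuous_smul := kContinuous₂_iff.mpr fun K r a => test' <|
      hsmul K r (@ContinuousMap.mk K M _ t a (test a.2)) }

end OfTopology

end Constructions

end KMod

namespace KMod

section Operations

variable {R : Type u} [Ring R] [TopologicalSpace R] {X : Type u} [TopologicalSpace X]
  [CompactlyGeneratedSpace X] {A : KMod.{u} R}

theorem add_continuous {f g : X → A} (hf : Continuous f) (hg : Continuous g) :
    Continuous fun x => f x + g x :=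
  A.continuous_add.comp hf hg

theorem smul_continuous {r : X → R} {f : X → A} (hr : Continuous r) (hf : Continuous f) :
    Continuous fun x => r x • f x :=
  A.continuous_smul.comp hr hf

end Operations

/-! ### Modules of maps -/

section FunMod

variable {R : Type u} [Ring R] [TopologicalSpace R] {W : Type u} [TopologicalSpace W]
  {Z : KMod.{u} R} (N : Submodule R (W → Z)) (hN : ∀ f ∈ N, Continuous f)

/-- The `R`-`k`-module given by a module of continuous maps with values in an `R`-`k`-module, with
the `k`-subspace topology of the `k`-compact-open topology. -/
def funMod : KMod.{u} R :=
  letI t : TopologicalSpace N :=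
    TopologicalSpace.induced (fun f => (⟨f.1, hN f.1 f.2⟩ : C(W, Z))) (kCompactOpen W Z)
  have key : ∀ {K : CompHaus.{u}} {g : K → N}, Continuous g ↔
      ∀ (L : CompHaus.{u}) (v : C(L, W)), Continuous fun p : K × L => (g p.1).1 (v p.2) :=
    continuous_induced_rng.trans continuous_kCompactOpen_iff
  -- Evaluation at `w` is the test against the one-point space. These evaluations separate
  -- functions, which gives weak Hausdorffness below.
  have point : ∀ {K : CompHaus.{u}} (g : C(K, N)) (w : W), Continuous fun k => (g k).1 w :=
    fun g w => (key.mp g.continuous (CompHaus.of PUnit.{u + 1}) (.const _ w)).comp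
      (Continuous.prodMk continuous_id (continuous_const (y := PUnit.unit)))
  ofTopology N t
    (fun K a b => key.mpr fun L v =>
      add_continuous (key.mp a.continuous L v) (key.mp b.continuous L v))
    (fun K r a => key.mpr fun L v =>
      smul_continuous (r.continuous.comp continuous_fst) (key.mp a.continuous L v))
    (fun K a b => by
      have : {k | a k = b k} = ⋂ w : W, {k | (a k).1 w = (b k).1 w} := by
        ext k
        simp only [Set.mem_ofPred_eq, Set.mem_iInter]
        exact ⟨fun h w => by rw [h], fun h => Subtype.ext (funext h)⟩
      rw [this]
      exact isClosed_iInter fun w => WeaklyHausdorffSpace.isClosed_eq (point a w) (point b w))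

/-- The exponential law. One direction restricts a map on `K × K` to the diagonal; the other applies
joint `k`-continuity to the test space `K × L`. -/
theorem continuous_funMod_iff {X : Type u} [TopologicalSpace X] [CompactlyGeneratedSpace X]
    {g : X → funMod N hN} :
    Continuous g ↔ KContinuous₂ fun (x : X) (w : W) => (show N from g x).1 w := by
  have key : ∀ {K : CompHaus.{u}} {g : K → funMod N hN}, Continuous g ↔
      ∀ (L : CompHaus.{u}) (v : C(L, W)),
        Continuous fun p : K × L => (show N from g p.1).1 (v p.2) :=
    continuous_to_compactlyGenerated_iff.trans
      (continuous_induced_rng.trans continuous_kCompactOpen_iff)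
  constructor
  · intro h
    refine kContinuous₂_iff.mpr fun K a b => ?_
    exact (key.mp (h.comp a.continuous) K b).comp (continuous_id.prodMk continuous_id)
  · intro h
    refine continuous_of_comp_compHaus fun K a => key.mpr fun L v => ?_
    exact kContinuous₂_iff.mp h (CompHaus.of (K × L)) ⟨fun p => a p.1, by fun_prop⟩
      ⟨fun p => v p.2, by fun_prop⟩

end FunMod

section MapMod

variable {R : Type u} [Ring R] [TopologicalSpace R] (W : Type u) [TopologicalSpace W]
  [CompactlyGeneratedSpace W] (Z : KMod.{u} R)

/-- The module of continuous maps from a compactly generated space to a `k`-module. -/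
def continuousMaps : Submodule R (W → Z) where
  carrier := {f | Continuous f}
  add_mem' := fun hf hg => add_continuous hf hg
  zero_mem' := continuous_const
  smul_mem' := fun _ _ hf => smul_continuous continuous_const hf

/-- The `k`-module of continuous maps from a compactly generated space to a `k`-module. -/
def mapMod : KMod.{u} R := funMod (continuousMaps W Z) fun _ h => h

end MapMod

section HomMod

/-- This is where centrality of the image of `Q` enters: `R`-linear maps are stable under `Q`, and
`Q`-linear maps into an `R`-module are stable under `R`. -/
theorem smul_algebraMap_comm {Q R : Type u} [CommRing Q] [Ring R] [TopologicalSpace R]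
    [Algebra Q R] (B : KMod.{u} R) (q : Q) (r : R) (b : B) :
    algebraMap Q R q • r • b = r • algebraMap Q R q • b := by
  rw [← mul_smul, ← mul_smul, Algebra.commutes]

variable {Q R : Type u} [CommRing Q] [TopologicalSpace Q] [Ring R] [TopologicalSpace R]
  [Algebra Q R] (hQR : Continuous (algebraMap Q R))

/-- Restriction of scalars along `Q → R`. -/
def restrict (B : KMod.{u} R) : KMod.{u} Q :=
  letI := Module.compHom B (algebraMap Q R)
  { carrier := B
    continuous_add := B.continuous_add
    continuous_neg := B.continuous_neg
    continuous_smul := B.continuous_smul.comp₂ hQR continuous_id continuous_id }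

theorem restrict_smul (B : KMod.{u} R) (q : Q) (b : restrict hQR B) :
    q • b = (algebraMap Q R q • (show B from b) : B) := rfl

/-- The `Q`-module of morphisms of `R`-`k`-modules, as a module of functions. -/
def homSubmodule (A B : KMod.{u} R) : Submodule Q (A → restrict hQR B) where
  carrier := {f | (∀ a a', f (a + a') = f a + f a') ∧
    (∀ (r : R) a, f (r • a) = (r • (show B from f a) : B)) ∧ Continuous f}
  add_mem' := fun {f g} hf hg =>
    ⟨fun a a' => by simp only [Pi.add_apply, hf.1, hg.1]; abel,
      fun r a => by simp only [Pi.add_apply, hf.2.1, hg.2.1]; exact (smul_add (A := B) r _ _).symm,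
      add_continuous hf.2.2 hg.2.2⟩
  zero_mem' := ⟨fun _ _ => (add_zero _).symm, fun r _ => (smul_zero (A := B) r).symm,
    continuous_const⟩
  smul_mem' := fun q f hf =>
    ⟨fun a a' => by simp only [Pi.smul_apply, hf.1, smul_add],
      fun r a => by
        simp only [Pi.smul_apply, hf.2.1, restrict_smul]
        exact smul_algebraMap_comm B q r _,
      smul_continuous continuous_const hf.2.2⟩

/-- The `Q`-`k`-module of morphisms of `R`-`k`-modules. -/
def homMod (A B : KMod.{u} R) : KMod.{u} Q :=
  funMod (homSubmodule hQR A B) fun _ h => h.2.2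

/-- The elements of `homMod` are the morphisms. -/
def homModEquiv (A B : KMod.{u} R) : homMod hQR A B ≃ (A ⟶ B) where
  toFun f := mkHom
    { toFun := (show homSubmodule hQR A B from f).1
      map_add' := (show homSubmodule hQR A B from f).2.1
      map_smul' := (show homSubmodule hQR A B from f).2.2.1 }
    (show homSubmodule hQR A B from f).2.2.2
  invFun φ := show homSubmodule hQR A B from
    ⟨φ, map_add (toLin φ), map_smul (toLin φ), continuous_hom φ⟩
  left_inv _ := rfl
  right_inv _ := rfl

variable {hQR}

theorem continuous_homMod_iff {A B : KMod.{u} R} {X : Type u} [TopologicalSpace X]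
    [CompactlyGeneratedSpace X] {g : X → homMod hQR A B} :
    Continuous g ↔ KContinuous₂ fun x (a : A) => homModEquiv hQR A B (g x) a :=
  continuous_funMod_iff _ _

theorem homMod_ext {A B : KMod.{u} R} {h h' : homMod hQR A B}
    (H : ∀ a, homModEquiv hQR A B h a = homModEquiv hQR A B h' a) : h = h' :=
  (homModEquiv hQR A B).injective (hom_ext H)

theorem kContinuous₂_homModEquiv (A B : KMod.{u} R) :
    KContinuous₂ fun (h : homMod hQR A B) (a : A) => homModEquiv hQR A B h a :=
  continuous_homMod_iff.mp continuous_id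

theorem isHomModule_homModEquiv (A B : KMod.{u} R) : IsHomModule (homModEquiv hQR A B) where
  add_apply _ _ _ := rfl
  smul_apply _ _ _ := rfl
  topology_eq := rfl

variable (hQR)

/-- The `Q`-linear morphisms into an `R`-`k`-module, as an `R`-module of functions. -/
def powerSubmodule (A : KMod.{u} Q) (B : KMod.{u} R) : Submodule R (A → B) where
  carrier := {f | (∀ a a', f (a + a') = f a + f a') ∧
    (∀ (q : Q) a, f (q • a) = algebraMap Q R q • f a) ∧ Continuous f}
  add_mem' := fun {f g} hf hg =>
    ⟨fun a a' => by simp only [Pi.add_apply, hf.1, hg.1]; abel,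
      fun r a => by simp only [Pi.add_apply, hf.2.1, hg.2.1, smul_add],
      add_continuous hf.2.2 hg.2.2⟩
  zero_mem' := ⟨fun _ _ => (add_zero _).symm, fun r _ => (smul_zero (A := B) _).symm,
    continuous_const⟩
  smul_mem' := fun q f hf =>
    ⟨fun a a' => by simp only [Pi.smul_apply, hf.1, smul_add],
      fun r a => by simp only [Pi.smul_apply, hf.2.1, smul_algebraMap_comm],
      smul_continuous continuous_const hf.2.2⟩

/-- The power of an `R`-`k`-module by a `Q`-`k`-module. -/
def power (A : KMod.{u} Q) (B : KMod.{u} R) : KMod.{u} R :=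
  funMod (powerSubmodule (R := R) A B) fun _ h => h.2.2

end HomMod

/-! ### The universal `k`-module on a module with a map from a `k`-space -/

section Reflect

variable {R : Type u} [Ring R] [TopologicalSpace R] {M : Type u} [AddCommGroup M] [Module R M]
  {S : KSpace.{u}} (t : S → M)

/-- A linear map from `M` to a `k`-module whose composite with `t : S → M` is continuous. -/
structure Extension (t : S → M) where
  target : KMod.{u} R
  toLinearMap : M →ₗ[R] target
  continuous_comp : Continuous fun s => toLinearMap (t s)

variable (R) in
/-- The elements of `M` that vanish in all `k`-modules. -/
def reflectKer : Submodule R M := ⨅ p : Extension (R := R) t, LinearMap.ker p.toLinearMap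

theorem reflectKer_le (p : Extension (R := R) t) : reflectKer R t ≤ LinearMap.ker p.toLinearMap :=
  iInf_le _ p

/-- The factorization of a linear map over the quotient by `reflectKer`. -/
def Extension.desc {t : S → M} (p : Extension (R := R) t) : M ⧸ reflectKer R t →ₗ[R] p.target :=
  (reflectKer R t).liftQ p.toLinearMap (reflectKer_le t p)

variable (R) in
/-- The universal `k`-module with a linear map from `M` whose composite with `t : S → M` is
continuous. -/
def reflect : KMod.{u} R :=
  -- The extensions form a family in a larger universe, but topologies on a fixed set have arbitrary
  -- infima, so no solution-set argument is needed.
  letI τ : TopologicalSpace (M ⧸ reflectKer R t) :=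
    ⨅ p : Extension (R := R) t, TopologicalSpace.induced p.desc p.target.topology
  have key : ∀ {K : CompHaus.{u}} {g : K → M ⧸ reflectKer R t}, Continuous g ↔
      ∀ p : Extension (R := R) t, Continuous fun k => p.desc (g k) :=
    continuous_iInf_rng.trans (forall_congr' fun _ => continuous_induced_rng)
  ofTopology (M ⧸ reflectKer R t) τ
    (fun K a b => key.mpr fun p => by
      simp only [map_add]
      exact add_continuous (key.mp a.continuous p) (key.mp b.continuous p))
    (fun K r a => key.mpr fun p => by
      simp only [map_smul]
      exact smul_continuous r.continuous (key.mp a.continuous p))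
    (fun K a b => by
      have : {k | a k = b k} = ⋂ p : Extension (R := R) t, {k | p.desc (a k) = p.desc (b k)} := by
        ext k
        simp only [Set.mem_ofPred_eq, Set.mem_iInter]
        refine ⟨fun h p => by rw [h], fun h => ?_⟩
        obtain ⟨x, hx⟩ := Submodule.Quotient.mk_surjective _ (a k)
        obtain ⟨y, hy⟩ := Submodule.Quotient.mk_surjective _ (b k)
        rw [← hx, ← hy] at h ⊢
        -- The extensions separate points of the quotient, since `reflectKer` is their common
        -- kernel.
        refine (Submodule.Quotient.eq _).mpr ((Submodule.mem_iInf _).mpr fun p => ?_)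
        rw [LinearMap.mem_ker, map_sub, sub_eq_zero]
        exact h p
      rw [this]
      exact isClosed_iInter fun p =>
        WeaklyHausdorffSpace.isClosed_eq (key.mp a.continuous p) (key.mp b.continuous p))

variable (R) in
/-- The canonical map to the universal `k`-module. -/
def toReflect : M →ₗ[R] reflect R t := (reflectKer R t).mkQ

theorem toReflect_surjective : Function.Surjective (toReflect R t) :=
  Submodule.Quotient.mk_surjective _

/-- The universal property of the initial topology survives `k`-ification because it is only tested
on compactly generated sources. -/
theorem continuous_reflect_iff {X : Type u} [TopologicalSpace X] [CompactlyGeneratedSpace X]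
    {g : X → reflect R t} :
    Continuous g ↔ ∀ p : Extension (R := R) t, Continuous fun x => p.desc (g x) := by
  have key : ∀ {K : CompHaus.{u}} {g : K → reflect R t}, Continuous g ↔
      ∀ p : Extension (R := R) t, Continuous fun k => p.desc (g k) :=
    continuous_to_compactlyGenerated_iff.trans
      (continuous_iInf_rng.trans (forall_congr' fun _ => continuous_induced_rng))
  constructor
  · exact fun h p => continuous_of_comp_compHaus fun K a => key.mp (h.comp a.continuous) p
  · exact fun h => continuous_of_comp_compHaus fun K a =>
      key.mpr fun p => (h p).comp a.continuous

theorem continuous_toReflect : Continuous fun s => toReflect R t (t s) :=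
  (continuous_reflect_iff t).mpr fun p => p.continuous_comp

variable {t}

/-- The universal property of the universal `k`-module. -/
def reflectLift {Z : KMod.{u} R} (φ : M →ₗ[R] Z) (hφ : Continuous fun s => φ (t s)) :
    reflect R t ⟶ Z :=
  mkHom (Extension.desc ⟨Z, φ, hφ⟩) ((continuous_reflect_iff t).mp continuous_id ⟨Z, φ, hφ⟩)

theorem reflect_hom_ext {Z : KMod.{u} R} (hspan : Submodule.span R (Set.range t) = ⊤)
    {f g : reflect R t ⟶ Z} (h : ∀ s, f (toReflect R t (t s)) = g (toReflect R t (t s))) :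
    f = g := by
  ext x
  obtain ⟨m, rfl⟩ := toReflect_surjective t x
  have : toLin f ∘ₗ toReflect R t = toLin g ∘ₗ toReflect R t :=
    LinearMap.ext_on_range hspan h
  exact LinearMap.congr_fun this m

/-- A family of morphisms out of the universal `k`-module is jointly continuous if it is jointly
continuous on generators. -/
theorem kContinuous₂_reflect (hspan : Submodule.span R (Set.range t) = ⊤) {W : Type u}
    [TopologicalSpace W] [CompactlyGeneratedSpace W] {Z : KMod.{u} R}
    (φ : W → (reflect R t ⟶ Z))
    (h : KContinuous₂ fun w s => φ w (toReflect R t (t s))) :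
    KContinuous₂ fun w x => φ w x := by
  -- For a fixed element, continuity in `w` propagates from the generators to their span. This makes
  -- the transpose `ψ` take values in continuous maps.
  have hm : ∀ m : M, Continuous fun w => φ w (toReflect R t m) := by
    intro m
    have hm : m ∈ Submodule.span R (Set.range t) := hspan ▸ Submodule.mem_top
    induction hm using Submodule.span_induction with
    | mem _ hx =>
      obtain ⟨s, rfl⟩ := hx
      exact h.comp continuous_id continuous_const
    | zero => simpa only [map_zero] using continuous_const
    | add _ _ _ _ hx hy => simpa only [map_add] using add_continuous hx hy
    | smul r _ _ hx => simpa only [map_smul] using smul_continuous continuous_const hx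
  let ψ : M →ₗ[R] mapMod W Z :=
    LinearMap.codRestrict (continuousMaps W Z)
      (LinearMap.pi fun w => toLin (φ w) ∘ₗ toReflect R t) hm
  -- By the exponential law, the hypothesis on generators says exactly that `ψ` is an extension, so
  -- it factors through `reflect`; uncurrying gives the claim.
  have hψ : Continuous fun s => ψ (t s) := (continuous_funMod_iff _ _).mpr h.swap
  have := (continuous_funMod_iff _ _).mp (continuous_hom (reflectLift ψ hψ))
  refine cast (congrArg KContinuous₂ ?_) this.swap
  funext w x
  obtain ⟨m, rfl⟩ := toReflect_surjective t x
  rfl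

end Reflect

end KMod

namespace KMod

/-! ### The tensor product -/

section Tensor

variable {Q : Type u} [CommRing Q] [TopologicalSpace Q] {A B C D E : KMod.{u} Q}

/-- The elementary tensors, as a map from the product of `k`-spaces. -/
def tensorGen (A B : KMod.{u} Q) : KSpace.prod ⟨A⟩ ⟨B⟩ → TensorProduct Q A B :=
  fun p => (show A × B from p).1 ⊗ₜ (show A × B from p).2

theorem span_range_tensorGen (A B : KMod.{u} Q) :
    Submodule.span Q (Set.range (tensorGen A B)) = ⊤ := by
  rw [← TensorProduct.span_tmul_eq_top]
  congr 1
  ext x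
  exact ⟨fun ⟨p, hp⟩ => ⟨p.1, p.2, hp⟩, fun ⟨a, b, h⟩ => ⟨(a, b), h⟩⟩

/-- The tensor product of `Q`-`k`-modules. -/
def tensor (A B : KMod.{u} Q) : KMod.{u} Q := reflect Q (tensorGen A B)

/-- The elementary tensors in the tensor product of `Q`-`k`-modules. -/
def tensorMk (a : A) (b : B) : tensor A B := toReflect Q (tensorGen A B) (a ⊗ₜ b)

theorem isKBilinear_tensorMk : IsKBilinear (tensorMk (A := A) (B := B)) where
  map_add_left a a' b :=
    (congrArg _ (TensorProduct.add_tmul a a' b)).trans (map_add (toReflect Q _) _ _)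
  map_add_right a b b' :=
    (congrArg _ (TensorProduct.tmul_add a b b')).trans (map_add (toReflect Q _) _ _)
  map_smul_left q a b :=
    (congrArg _ (TensorProduct.smul_tmul' q a b).symm).trans (map_smul (toReflect Q _) _ _)
  map_smul_right q a b :=
    (congrArg _ (TensorProduct.tmul_smul q a b)).trans (map_smul (toReflect Q _) _ _)
  continuous := continuous_toReflect (tensorGen A B)

/-- The morphism out of a tensor product given by a bilinear map. -/
def tensorLift (f : A → B → C) (hf : IsKBilinear f) : tensor A B ⟶ C :=
  reflectLift (TensorProduct.lift (LinearMap.mk₂ Q f hf.map_add_left hf.map_smul_left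
    hf.map_add_right hf.map_smul_right)) hf.continuous

theorem tensor_hom_ext {f g : tensor A B ⟶ C}
    (h : ∀ a b, f (tensorMk a b) = g (tensorMk a b)) : f = g :=
  reflect_hom_ext (span_range_tensorGen A B) fun p => h p.1 p.2

theorem isTensorProduct_tensorMk : IsTensorProduct (tensorMk (A := A) (B := B)) where
  isKBilinear := isKBilinear_tensorMk
  existsUnique _ f hf := ⟨tensorLift f hf, fun _ _ => rfl,
    fun _ hg => tensor_hom_ext hg⟩

theorem IsKBilinear.comp {A' B' : KMod.{u} Q} {f : A → B → C} (hf : IsKBilinear f)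
    (g : A' ⟶ A) (h : B' ⟶ B) (k : C ⟶ D) : IsKBilinear fun a b => k (f (g a) (h b)) where
  map_add_left a a' b := by simp only [← toLin_apply, map_add, hf.map_add_left]
  map_add_right a b b' := by simp only [← toLin_apply, map_add, hf.map_add_right]
  map_smul_left q a b := by simp only [← toLin_apply, map_smul, hf.map_smul_left]
  map_smul_right q a b := by simp only [← toLin_apply, map_smul, hf.map_smul_right]
  continuous := hf.continuous.comp₂ (continuous_hom g) (continuous_hom h) (continuous_hom k)

theorem IsKBilinear.swap {f : A → B → C} (hf : IsKBilinear f) : IsKBilinear fun b a => f a b where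
  map_add_left b b' a := hf.map_add_right a b b'
  map_add_right b a a' := hf.map_add_left a a' b
  map_smul_left q b a := hf.map_smul_right q a b
  map_smul_right q b a := hf.map_smul_left q a b
  continuous := hf.continuous.swap

theorem isKBilinear_smul [IsKRing Q] (A : KMod.{u} Q) :
    IsKBilinear fun (q : self Q) (a : A) => (show Q from q) • a where
  map_add_left q q' a := add_smul (show Q from q) q' a
  map_add_right q a b := smul_add (show Q from q) a b
  map_smul_left q q' a := mul_smul q (show Q from q') a
  map_smul_right q q' a := smul_comm (show Q from q') q a
  continuous := A.continuous_smul

/-- The internal hom of `Q`-`k`-modules. -/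
abbrev internalHom (A B : KMod.{u} Q) : KMod.{u} Q :=
  homMod (Q := Q) (R := Q) continuous_id A B

/-- Internal homs of `Q`-`k`-modules consist of the morphisms. -/
abbrev internalHomEquiv (A B : KMod.{u} Q) : internalHom A B ≃ (A ⟶ B) :=
  homModEquiv (Q := Q) (R := Q) continuous_id A B

theorem isKBilinear_internalHomEquiv (A B : KMod.{u} Q) :
    IsKBilinear fun (h : internalHom A B) (a : A) => internalHomEquiv A B h a where
  map_add_left _ _ _ := rfl
  map_add_right h := map_add (toLin (internalHomEquiv A B h))
  map_smul_left _ _ _ := rfl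
  map_smul_right q h := map_smul (toLin (internalHomEquiv A B h)) q
  continuous := kContinuous₂_homModEquiv A B

/-- The partial application of a bilinear map. -/
def IsKBilinear.apply {f : A → B → C} (hf : IsKBilinear f) (a : A) : B ⟶ C :=
  mkHom ⟨⟨f a, hf.map_add_right a⟩, fun q => hf.map_smul_right q a⟩
    (hf.continuous.comp continuous_const continuous_id)

/-- The morphism to an internal hom given by a bilinear map. -/
def IsKBilinear.curry {f : A → B → C} (hf : IsKBilinear f) : A ⟶ internalHom B C :=
  mkHom
    { toFun := fun a => (internalHomEquiv B C).symm (hf.apply a)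
      map_add' := fun a a' => homMod_ext (hf.map_add_left a a')
      map_smul' := fun q a => homMod_ext (hf.map_smul_left q a) }
    (continuous_homMod_iff.mpr hf.continuous)

/-- A morphism to an internal hom gives a bilinear map. -/
theorem isKBilinear_uncurry (g : A ⟶ internalHom B C) :
    IsKBilinear fun a b => internalHomEquiv B C (g a) b :=
  (isKBilinear_internalHomEquiv B C).comp g (𝟙 B) (𝟙 C)

/-- A trilinear map gives a bilinear map to an internal hom. -/
theorem isKBilinear_internalHom {f : A → B → internalHom C D}
    (h₁ : ∀ c, IsKBilinear fun a b => internalHomEquiv C D (f a b) c)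
    (h₂ : ∀ (K : CompHaus.{u}) (a : C(K, A)) (b : C(K, B)) (c : C(K, C)),
      Continuous fun k => internalHomEquiv C D (f (a k) (b k)) (c k)) : IsKBilinear f where
  map_add_left a a' b := homMod_ext fun c => (h₁ c).map_add_left a a' b
  map_add_right a b b' := homMod_ext fun c => (h₁ c).map_add_right a b b'
  map_smul_left q a b := homMod_ext fun c => (h₁ c).map_smul_left q a b
  map_smul_right q a b := homMod_ext fun c => (h₁ c).map_smul_right q a b
  continuous := kContinuous₂_iff.mpr fun K a b => continuous_homMod_iff.mpr <|
    kContinuous₂_iff.mpr fun L v c =>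
      h₂ L ⟨fun k => a (v k), by fun_prop⟩ ⟨fun k => b (v k), by fun_prop⟩ c

/-- The action of the tensor product on morphisms. -/
def tensorMap (f : A ⟶ C) (g : B ⟶ D) : tensor A B ⟶ tensor C D :=
  tensorLift _ (isKBilinear_tensorMk.comp f g (𝟙 _))

/-- The symmetry of the tensor product. -/
def tensorSwap (A B : KMod.{u} Q) : tensor A B ≅ tensor B A where
  hom := tensorLift _ isKBilinear_tensorMk.swap
  inv := tensorLift _ isKBilinear_tensorMk.swap
  hom_inv_id := tensor_hom_ext fun _ _ => rfl
  inv_hom_id := tensor_hom_ext fun _ _ => rfl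

/-- With `c` fixed, `x ↦ x ⊗ c` is a morphism, which leaves two morphisms out of `A ⊗ B` to compare.
-/
theorem tensor_hom_ext₃ {f g : tensor (tensor A B) C ⟶ D}
    (h : ∀ a b c, f (tensorMk (tensorMk a b) c) = g (tensorMk (tensorMk a b) c)) : f = g :=
  tensor_hom_ext fun x c => ConcreteCategory.congr_hom
    (tensor_hom_ext (f := (isKBilinear_tensorMk.swap.apply c) ≫ f)
      (g := (isKBilinear_tensorMk.swap.apply c) ≫ g) fun a b => h a b c) x

theorem tensor_hom_ext₄ {f g : tensor (tensor (tensor A B) C) D ⟶ E}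
    (h : ∀ a b c d, f (tensorMk (tensorMk (tensorMk a b) c) d) =
      g (tensorMk (tensorMk (tensorMk a b) c) d)) : f = g :=
  tensor_hom_ext fun x d => ConcreteCategory.congr_hom
    (tensor_hom_ext₃ (f := (isKBilinear_tensorMk.swap.apply d) ≫ f)
      (g := (isKBilinear_tensorMk.swap.apply d) ≫ g) fun a b c => h a b c d) x

/-- The map `(A ⊗ B) ⊗ C ⟶ A ⊗ (B ⊗ C)`. -/
def tensorAssocHom (A B C : KMod.{u} Q) : tensor (tensor A B) C ⟶ tensor A (tensor B C) :=
  -- The factor `C` is moved into an internal hom, so that the universal property of `A ⊗ B` applies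
  -- while `c` varies continuously.
  have h : IsKBilinear fun (a : A) (b : B) =>
      (internalHomEquiv C (tensor A (tensor B C))).symm
        ((isKBilinear_tensorMk.apply b) ≫ (isKBilinear_tensorMk.apply a)) :=
    isKBilinear_internalHom
      (fun c => isKBilinear_tensorMk.comp (𝟙 A) (isKBilinear_tensorMk.swap.apply c) (𝟙 _))
      (fun _ a b c => isKBilinear_tensorMk.continuous.comp a.continuous
        (isKBilinear_tensorMk.continuous.comp b.continuous c.continuous))
  tensorLift _ (isKBilinear_uncurry (tensorLift _ h))

/-- The associativity of the tensor product. -/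
def tensorAssoc (A B C : KMod.{u} Q) : tensor (tensor A B) C ≅ tensor A (tensor B C) where
  hom := tensorAssocHom A B C
  -- The inverse is the forward map for `C, B, A` conjugated by symmetries.
  inv := (tensorSwap A (tensor B C)).hom ≫ tensorMap (tensorSwap B C).hom (𝟙 A) ≫
    tensorAssocHom C B A ≫ (tensorSwap C (tensor B A)).hom ≫ tensorMap (tensorSwap B A).hom (𝟙 C)
  hom_inv_id := tensor_hom_ext₃ fun _ _ _ => rfl
  inv_hom_id := by
    -- Precomposing with symmetries makes the source `(B ⊗ C) ⊗ A`, to which `tensor_hom_ext₃`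
    -- applies.
    rw [← cancel_epi ((tensorSwap A (tensor B C)) ≪≫ (tensorSwap _ _)).hom,
      ← cancel_epi (tensorSwap (tensor B C) A).hom]
    exact tensor_hom_ext₃ fun _ _ _ => rfl

variable [IsKRing Q]

/-- The unit isomorphism of the tensor product. -/
def tensorUnitLeft (A : KMod.{u} Q) : tensor (self Q) A ≅ A where
  hom := tensorLift _ (isKBilinear_smul A)
  inv := isKBilinear_tensorMk.apply (A := self Q) (1 : Q)
  hom_inv_id := tensor_hom_ext fun q a =>
    (isKBilinear_tensorMk.map_smul_right (show Q from q) _ a).trans <|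
      (isKBilinear_tensorMk.map_smul_left (show Q from q) _ a).symm.trans <|
        congrArg (fun q => tensorMk (A := self Q) q a) (mul_one (show Q from q))
  inv_hom_id := hom_ext fun a => one_smul Q a

variable (Q) in
/-- The monoidal structure on `Q`-`k`-modules. -/
@[reducible]
def monoidalCategoryStruct : MonoidalCategoryStruct (KMod.{u} Q) where
  tensorObj := tensor
  tensorUnit := self Q
  tensorHom := tensorMap
  whiskerLeft A _ _ g := tensorMap (𝟙 A) g
  whiskerRight f B := tensorMap f (𝟙 B)
  associator := tensorAssoc
  leftUnitor := tensorUnitLeft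
  rightUnitor A := tensorSwap A (self Q) ≪≫ tensorUnitLeft A

variable (Q) in
/-- The monoidal category of `Q`-`k`-modules. -/
@[reducible]
def monoidalCategory : MonoidalCategory (KMod.{u} Q) :=
  letI := monoidalCategoryStruct Q
  .ofTensorHom
    (id_tensorHom_id := fun _ _ => tensor_hom_ext fun _ _ => rfl)
    (id_tensorHom := fun _ _ _ _ => rfl)
    (tensorHom_id := fun _ _ => rfl)
    (tensorHom_comp_tensorHom := fun _ _ _ _ => tensor_hom_ext fun _ _ => rfl)
    (associator_naturality := fun _ _ _ => tensor_hom_ext₃ fun _ _ _ => rfl)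
    (leftUnitor_naturality := fun f => tensor_hom_ext fun q a => (map_smul (toLin f) (show Q from q) a).symm)
    (rightUnitor_naturality := fun f => tensor_hom_ext fun a q => (map_smul (toLin f) (show Q from q) a).symm)
    (pentagon := fun _ _ _ _ => tensor_hom_ext₄ fun _ _ _ _ => rfl)
    (triangle := fun _ _ => tensor_hom_ext₃ fun a q b =>
      (isKBilinear_tensorMk.map_smul_right (show Q from q) a b).trans
        (isKBilinear_tensorMk.map_smul_left (show Q from q) a b).symm)

attribute [local instance] monoidalCategory

variable (Q) in
/-- The symmetric monoidal category of `Q`-`k`-modules. -/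
@[reducible]
def symmetricCategory : SymmetricCategory (KMod.{u} Q) where
  braiding := tensorSwap
  braiding_naturality_right _ _ _ _ := tensor_hom_ext fun _ _ => rfl
  braiding_naturality_left _ _ := tensor_hom_ext fun _ _ => rfl
  hexagon_forward _ _ _ := tensor_hom_ext₃ fun _ _ _ => rfl
  hexagon_reverse A B C := by
    rw [← cancel_epi (α_ A B C).hom]
    exact tensor_hom_ext₃ fun _ _ _ => rfl
  symmetry _ _ := tensor_hom_ext fun _ _ => rfl

attribute [local instance] symmetricCategory

variable (Q) in
/-- The symmetric monoidal structure on `Q`-`k`-modules is the one given by the tensor product. -/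
def tensorStructure : TensorStructure Q where
  tmul := tensorMk
  isTensorProduct _ _ := isTensorProduct_tensorMk
  unitIso := Iso.refl _
  tensorHom_tmul _ _ _ _ := rfl
  associator_tmul _ _ _ := rfl
  leftUnitor_tmul _ _ := rfl
  rightUnitor_tmul _ _ := rfl
  braiding_tmul _ _ := rfl

end Tensor

end KMod

noncomputable section

namespace KMod

/-! ### The closed structure and morphisms out of the unit -/

section Closed

variable {Q : Type u} [CommRing Q] [TopologicalSpace Q] [IsKRing Q]

attribute [local instance] monoidalCategory symmetricCategory

/-- The internal hom functor. -/
def internalHomFunctor (A : KMod.{u} Q) : KMod.{u} Q ⥤ KMod.{u} Q where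
  obj B := internalHom A B
  map {B _} f := ((isKBilinear_internalHomEquiv A B).comp (𝟙 _) (𝟙 _) f).curry

/-- The tensor product is left adjoint to the internal hom. -/
def tensorHomAdjunction (A : KMod.{u} Q) : tensorLeft A ⊣ internalHomFunctor A :=
  Adjunction.mkOfHomEquiv
    { homEquiv := fun X Y =>
        { toFun := fun g => (isKBilinear_tensorMk.swap.comp (𝟙 X) (𝟙 A) g).curry
          invFun := fun k => tensorLift (fun a x => internalHomEquiv A Y (k x) a)
            (isKBilinear_uncurry k).swap
          left_inv := fun _ => tensor_hom_ext fun _ _ => rfl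
          right_inv := fun _ => rfl }
      homEquiv_naturality_left_symm := fun _ _ => tensor_hom_ext fun _ _ => rfl
      homEquiv_naturality_right := fun _ _ => rfl }

variable (Q) in
/-- The closed monoidal structure on `Q`-`k`-modules. -/
@[reducible]
def monoidalClosed : MonoidalClosed (KMod.{u} Q) where
  closed A := ⟨internalHomFunctor A, tensorHomAdjunction A⟩

attribute [local instance] monoidalClosed

theorem ev_tensorMk (A B : KMod.{u} Q) (a : A) (h : internalHom A B) :
    (ihom.ev A).app B ((tensorStructure Q).tmul a h) = internalHomEquiv A B h a := rfl

/-- The map `a ↦ 1 ⊗ a` is the inverse of the left unitor, hence epi. Unit laws can therefore be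
checked at the scalar `1`. -/
theorem unit_tensor_hom_ext {A B : KMod.{u} Q} {f g : tensor (self Q) A ⟶ B}
    (h : ∀ a, f (tensorMk (A := self Q) (1 : Q) a) = g (tensorMk (A := self Q) (1 : Q) a)) :
    f = g := by
  rw [← cancel_epi (tensorUnitLeft A).inv]
  exact hom_ext h

theorem tensor_unit_hom_ext {A B : KMod.{u} Q} {f g : tensor A (self Q) ⟶ B}
    (h : ∀ a, f (tensorMk (B := self Q) a (1 : Q)) = g (tensorMk (B := self Q) a (1 : Q))) :
    f = g := by
  rw [← cancel_epi (tensorSwap (self Q) A).hom]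
  exact unit_tensor_hom_ext h

theorem unit_hom_ext {B : KMod.{u} Q} {f g : self Q ⟶ B}
    (h : f (show self Q from (1 : Q)) = g (show self Q from (1 : Q))) : f = g := by
  have key : ∀ (f : self Q ⟶ B) (q : Q), f (show self Q from q) =
      q • f (show self Q from (1 : Q)) := fun f q =>
    (congrArg f (mul_one q).symm).trans (map_smul (toLin f) q (show self Q from (1 : Q)))
  exact hom_ext fun q => by rw [key f q, key g q, h]

/-- The morphism from the unit given by an element. -/
def ofElement {A : KMod.{u} Q} (a : A) : self Q ⟶ A := (isKBilinear_smul A).swap.apply a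

theorem ofElement_one {A : KMod.{u} Q} (a : A) : ofElement a (show self Q from (1 : Q)) = a :=
  one_smul Q a

end Closed

/-! ### The free `k`-module on a `k`-space -/

section Free

variable (Q : Type u) [CommRing Q]

/-- The basis elements in the abstract free module on a `k`-space. -/
def freeGen (X : KSpace.{u}) : X → (X →₀ Q) := fun x => Finsupp.single x 1

theorem span_range_freeGen (X : KSpace.{u}) :
    Submodule.span Q (Set.range (freeGen Q X)) = ⊤ :=
  (Finsupp.basisSingleOne (R := Q) (ι := X)).span_eq ▸ by
    congr 2

variable [TopologicalSpace Q]

/-- The free `Q`-`k`-module on a `k`-space. -/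
def free (X : KSpace.{u}) : KMod.{u} Q := reflect Q (freeGen Q X)

/-- The universal map to the free `Q`-`k`-module. -/
def toFree (X : KSpace.{u}) : C(X, free Q X) :=
  ⟨fun x => toReflect Q (freeGen Q X) (freeGen Q X x), continuous_toReflect _⟩

variable {Q} {X Y Z : KSpace.{u}} {A B : KMod.{u} Q}

/-- The universal property of the free `Q`-`k`-module. -/
def freeLift (g : C(X, A)) : free Q X ⟶ A :=
  reflectLift (Finsupp.linearCombination Q g) (by
    simpa only [freeGen, Finsupp.linearCombination_single, one_smul] using g.continuous)

@[simp]
theorem freeLift_toFree (g : C(X, A)) (x : X) : freeLift g (toFree Q X x) = g x :=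
  (Finsupp.linearCombination_single Q 1 x).trans (one_smul Q (g x))

theorem free_hom_ext {f g : free Q X ⟶ A} (h : ∀ x, f (toFree Q X x) = g (toFree Q X x)) :
    f = g :=
  reflect_hom_ext (span_range_freeGen Q X) h

variable (Q) in
/-- The free functor from `k`-spaces to `Q`-`k`-modules. -/
def freeFunctor : KSpace.{u} ⥤ KMod.{u} Q where
  obj X := free Q X
  map {_ Y} f := freeLift ((toFree Q Y).comp f)
  map_id _ := free_hom_ext fun x => freeLift_toFree _ x
  map_comp {_ _ Z} f g := free_hom_ext fun x => (freeLift_toFree _ x).trans <|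
    ((congrArg (freeLift ((toFree Q Z).comp g)) (freeLift_toFree _ x)).trans
      (freeLift_toFree _ (f x))).symm

theorem freeFunctor_map_toFree (f : X ⟶ Y) (x : X) :
    (freeFunctor Q).map f (toFree Q X x) = toFree Q Y (f x) := freeLift_toFree _ x

variable (Q) in
/-- The free functor is left adjoint to the forgetful functor. -/
def freeAdjunction : freeFunctor Q ⊣ forgetToKSpace Q :=
  Adjunction.mkOfHomEquiv
    { homEquiv := fun X _ =>
        { toFun := fun f => ContinuousMap.comp ⟨fun a => f a, continuous_hom f⟩ (toFree Q X)
          invFun := fun g => freeLift g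
          left_inv := fun _ => free_hom_ext fun x => freeLift_toFree _ x
          right_inv := fun _ => ConcreteCategory.hom_ext _ _ fun x => freeLift_toFree _ x }
      homEquiv_naturality_left_symm := fun f g => free_hom_ext fun x =>
        (freeLift_toFree _ x).trans ((congrArg (freeLift g) (freeLift_toFree _ x)).trans
          (freeLift_toFree g (f x))).symm
      homEquiv_naturality_right := fun _ _ => rfl }

theorem tensor_free_hom_ext {f g : tensor (free Q X) (free Q Y) ⟶ A}
    (h : ∀ x y, f (tensorMk (toFree Q X x) (toFree Q Y y)) =
      g (tensorMk (toFree Q X x) (toFree Q Y y))) : f = g :=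
  tensor_hom_ext fun a b => ConcreteCategory.congr_hom
    (free_hom_ext (f := isKBilinear_tensorMk.apply a ≫ f) (g := isKBilinear_tensorMk.apply a ≫ g)
      fun y => ConcreteCategory.congr_hom
        (free_hom_ext (f := isKBilinear_tensorMk.swap.apply (toFree Q Y y) ≫ f)
          (g := isKBilinear_tensorMk.swap.apply (toFree Q Y y) ≫ g) fun x => h x y) a) b

theorem tensor_free_hom_ext₃ {f g : tensor (tensor (free Q X) (free Q Y)) (free Q Z) ⟶ A}
    (h : ∀ x y z, f (tensorMk (tensorMk (toFree Q X x) (toFree Q Y y)) (toFree Q Z z)) =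
      g (tensorMk (tensorMk (toFree Q X x) (toFree Q Y y)) (toFree Q Z z))) : f = g :=
  tensor_hom_ext fun a b => ConcreteCategory.congr_hom
    (free_hom_ext (f := isKBilinear_tensorMk.apply a ≫ f) (g := isKBilinear_tensorMk.apply a ≫ g)
      fun z => ConcreteCategory.congr_hom
        (tensor_free_hom_ext (f := isKBilinear_tensorMk.swap.apply (toFree Q Z z) ≫ f)
          (g := isKBilinear_tensorMk.swap.apply (toFree Q Z z) ≫ g) fun x y => h x y z) a) b

/-- The bilinear extension of a continuous map on a product of `k`-spaces. -/
def freeLift₂ (g : C(KSpace.prod X Y, A)) : tensor (free Q X) (free Q Y) ⟶ A :=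
  have h (x : X) : Continuous fun y : Y => g (show X × Y from (x, y)) :=
    KContinuous₂.comp (f := fun x y => g (show X × Y from (x, y))) g.continuous
      continuous_const continuous_id
  tensorLift _ (isKBilinear_uncurry (freeLift (A := internalHom (free Q Y) A)
    ⟨fun x => (internalHomEquiv _ _).symm (freeLift ⟨_, h x⟩),
      -- The map sending `x` to the linear extension of `g (x, -)` is continuous into the internal
      -- hom, since joint continuity need only be checked on the generators `y`.
      continuous_homMod_iff.mpr <| kContinuous₂_reflect (span_range_freeGen Q Y) _ <|
        (congrArg KContinuous₂ (funext₂ fun x y => freeLift_toFree ⟨_, h x⟩ y)).mpr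
          g.continuous⟩))

theorem freeLift₂_toFree (g : C(KSpace.prod X Y, A)) (x : X) (y : Y) :
    freeLift₂ g (tensorMk (toFree Q X x) (toFree Q Y y)) = g (show X × Y from (x, y)) := by
  refine (congrArg (fun k => internalHomEquiv (free Q Y) A k (toFree Q Y y))
    (freeLift_toFree _ x)).trans ?_
  exact freeLift_toFree _ y

variable (Q) in
/-- The multiplication isomorphism of the free functor. -/
def freeMulIso (X Y : KSpace.{u}) :
    tensor (free Q X) (free Q Y) ≅ free Q (KSpace.prod X Y) where
  hom := freeLift₂ (toFree Q (KSpace.prod X Y))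
  inv := freeLift ⟨fun p => tensorMk (toFree Q X (show X × Y from p).1)
    (toFree Q Y (show X × Y from p).2),
    isKBilinear_tensorMk.continuous.comp₂ (toFree Q X).continuous (toFree Q Y).continuous
      continuous_id⟩
  hom_inv_id := tensor_free_hom_ext fun x y =>
    (congrArg _ (freeLift₂_toFree _ x y)).trans (freeLift_toFree _ _)
  inv_hom_id := free_hom_ext fun p =>
    (congrArg _ (freeLift_toFree _ p)).trans (freeLift₂_toFree _ _ _)

theorem freeMulIso_hom_toFree (x : X) (y : Y) :
    (freeMulIso Q X Y).hom (tensorMk (toFree Q X x) (toFree Q Y y)) =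
      toFree Q (KSpace.prod X Y) (show X × Y from (x, y)) := freeLift₂_toFree _ x y

variable [IsKRing Q]

attribute [local instance] monoidalCategory symmetricCategory

variable (Q) in
/-- The unit isomorphism of the free functor. -/
def freeUnitIso : self Q ≅ free Q KSpace.point.{u} where
  hom := ofElement (toFree Q KSpace.point PUnit.unit)
  inv := freeLift (.const _ (show self Q from (1 : Q)))
  hom_inv_id := unit_hom_ext <| (congrArg _ (ofElement_one _)).trans (freeLift_toFree _ _)
  inv_hom_id := free_hom_ext fun _ =>
    (congrArg (ofElement (toFree Q KSpace.point PUnit.unit)) (freeLift_toFree _ _)).trans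
      (ofElement_one _)

theorem freeUnitIso_hom_one :
    (freeUnitIso Q).hom (show self Q from (1 : Q)) = toFree Q KSpace.point PUnit.unit :=
  ofElement_one _

theorem freeMulIso_hom_unit_left (x : X) :
    (freeMulIso Q KSpace.point X).hom
      (tensorMk ((freeUnitIso Q).hom (show self Q from (1 : Q))) (toFree Q X x)) =
      toFree Q (KSpace.prod KSpace.point X) (show PUnit × X from (PUnit.unit, x)) := by
  rw [freeUnitIso_hom_one]
  exact freeMulIso_hom_toFree _ _

theorem freeMulIso_hom_unit_right (x : X) :
    (freeMulIso Q X KSpace.point).hom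
      (tensorMk (toFree Q X x) ((freeUnitIso Q).hom (show self Q from (1 : Q)))) =
      toFree Q (KSpace.prod X KSpace.point) (show X × PUnit from (x, PUnit.unit)) := by
  rw [freeUnitIso_hom_one]
  exact freeMulIso_hom_toFree _ _

variable (Q) in
/-- The free functor is strong monoidal. -/
def freeCoreMonoidal : (freeFunctor.{u} Q).CoreMonoidal where
  εIso := freeUnitIso Q
  μIso X Y := freeMulIso Q X Y
  μIso_hom_natural_left {_ Y} f X' := tensor_free_hom_ext fun x x' =>
    (congrArg (fun a => (freeMulIso Q Y X').hom (tensorMk a (toFree Q X' x')))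
      (freeFunctor_map_toFree f x)).trans <| (freeMulIso_hom_toFree _ _).trans <|
      ((congrArg ((freeFunctor Q).map (f ▷ X')) (freeMulIso_hom_toFree x x')).trans
        (freeFunctor_map_toFree (f ▷ X') _)).symm
  μIso_hom_natural_right {_ Y} X' f := tensor_free_hom_ext fun x' x =>
    (congrArg (fun a => (freeMulIso Q X' Y).hom (tensorMk (toFree Q X' x') a))
      (freeFunctor_map_toFree f x)).trans <| (freeMulIso_hom_toFree _ _).trans <|
      ((congrArg ((freeFunctor Q).map (X' ◁ f)) (freeMulIso_hom_toFree x' x)).trans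
        (freeFunctor_map_toFree (X' ◁ f) _)).symm
  associativity X Y Z := tensor_free_hom_ext₃ fun x y z =>
    (congrArg (fun a => (freeFunctor Q).map (α_ X Y Z).hom
      ((freeMulIso Q (X ⊗ Y) Z).hom (tensorMk a (toFree Q Z z))))
        (freeMulIso_hom_toFree x y)).trans <|
      (congrArg ((freeFunctor Q).map (α_ X Y Z).hom) (freeMulIso_hom_toFree _ z)).trans <|
      (freeFunctor_map_toFree (α_ X Y Z).hom _).trans <|
      ((congrArg (fun a => (freeMulIso Q X (Y ⊗ Z)).hom (tensorMk (toFree Q X x) a))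
        (freeMulIso_hom_toFree y z)).trans (freeMulIso_hom_toFree x _)).symm
  left_unitality X := (cancel_epi (tensorUnitLeft (free Q X)).inv).mp <| free_hom_ext fun x =>
    (one_smul Q (toFree Q X x)).trans
      ((congrArg ((freeFunctor Q).map (λ_ X).hom) (freeMulIso_hom_unit_left x)).trans
        (freeFunctor_map_toFree (λ_ X).hom _)).symm
  right_unitality X := (cancel_epi
    ((tensorUnitLeft (free Q X)).symm ≪≫ tensorSwap _ _).hom).mp <| free_hom_ext fun x =>
    (one_smul Q (toFree Q X x)).trans
      ((congrArg ((freeFunctor Q).map (ρ_ X).hom) (freeMulIso_hom_unit_right x)).trans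
        (freeFunctor_map_toFree (ρ_ X).hom _)).symm

end Free

/-! ### The universal `k`-module on an abstract module -/

section OfModule

variable {Q : Type u} [CommRing Q] [TopologicalSpace Q] {M N P : ModuleCat.{u} Q} {A : KMod.{u} Q}

variable (M) in
/-- The universal `k`-module on an abstract module. -/
def ofModule : KMod.{u} Q := reflect Q (S := KSpace.point) (fun _ => (0 : M))

variable (M) in
/-- The universal map to the `k`-module on an abstract module. -/
def toOfModule : M →ₗ[Q] ofModule M := toReflect Q (S := KSpace.point) (fun _ => (0 : M))

/-- The universal property of the `k`-module on an abstract module. -/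
def ofModuleLift (g : M →ₗ[Q] A) : ofModule M ⟶ A := reflectLift g continuous_const

/-- The zero map from a point does not span `M` in general, so surjectivity of `toReflect` takes the
place of `reflect_hom_ext`. -/
theorem ofModule_hom_ext {f g : ofModule M ⟶ A}
    (h : ∀ m, f (toOfModule M m) = g (toOfModule M m)) : f = g :=
  hom_ext fun x => by
    obtain ⟨m, rfl⟩ := toReflect_surjective _ x
    exact h m

variable (Q) in
/-- The left adjoint of the forgetful functor to abstract modules. -/
def ofModuleFunctor : ModuleCat.{u} Q ⥤ KMod.{u} Q where
  obj M := ofModule M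
  map {_ N} f := ofModuleLift (toOfModule N ∘ₗ f.hom)
  map_id _ := ofModule_hom_ext fun _ => rfl
  map_comp _ _ := ofModule_hom_ext fun _ => rfl

variable (Q) in
/-- The functor `ofModuleFunctor` is left adjoint to the forgetful functor. -/
def ofModuleAdjunction : ofModuleFunctor Q ⊣ forgetToModuleCat Q :=
  Adjunction.mkOfHomEquiv
    { homEquiv := fun M _ =>
        { toFun := fun f => ModuleCat.ofHom (toLin f ∘ₗ toOfModule M)
          invFun := fun g => ofModuleLift g.hom
          left_inv := fun _ => ofModule_hom_ext fun _ => rfl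
          right_inv := fun _ => rfl }
      homEquiv_naturality_left_symm := fun _ _ => ofModule_hom_ext fun _ => rfl
      homEquiv_naturality_right := fun _ _ => rfl }

theorem ofModule_tensor_hom_ext
    {f g : ofModule (ModuleCat.of Q (TensorProduct Q M N)) ⟶ A}
    (h : ∀ (m : M) (n : N), f (toOfModule (ModuleCat.of Q (TensorProduct Q M N)) (m ⊗ₜ n)) =
      g (toOfModule (ModuleCat.of Q (TensorProduct Q M N)) (m ⊗ₜ n))) : f = g :=
  ofModule_hom_ext <| LinearMap.congr_fun <| TensorProduct.ext'
    (g := toLin f ∘ₗ toOfModule (ModuleCat.of Q (TensorProduct Q M N)))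
    (h := toLin g ∘ₗ toOfModule (ModuleCat.of Q (TensorProduct Q M N))) h

theorem tensor_ofModule_hom_ext {f g : tensor (ofModule M) (ofModule N) ⟶ A}
    (h : ∀ m n, f (tensorMk (toOfModule M m) (toOfModule N n)) =
      g (tensorMk (toOfModule M m) (toOfModule N n))) : f = g :=
  tensor_hom_ext fun a b => by
    obtain ⟨m, rfl⟩ := toReflect_surjective _ a
    obtain ⟨n, rfl⟩ := toReflect_surjective _ b
    exact h m n

theorem tensor_ofModule_hom_ext₃
    {f g : tensor (tensor (ofModule M) (ofModule N)) (ofModule P) ⟶ A}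
    (h : ∀ m n p,
      f (tensorMk (tensorMk (toOfModule M m) (toOfModule N n)) (toOfModule P p)) =
      g (tensorMk (tensorMk (toOfModule M m) (toOfModule N n)) (toOfModule P p))) : f = g :=
  tensor_hom_ext₃ fun a b c => by
    obtain ⟨m, rfl⟩ := toReflect_surjective _ a
    obtain ⟨n, rfl⟩ := toReflect_surjective _ b
    obtain ⟨p, rfl⟩ := toReflect_surjective _ c
    exact h m n p

/-- The extension of an abstract bilinear map. -/
def ofModuleLift₂ (g : M →ₗ[Q] N →ₗ[Q] A) : tensor (ofModule M) (ofModule N) ⟶ A :=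
  -- Every abstract linear map to a `k`-module extends over `ofModule`, so currying leaves only
  -- linearity in `m` to prove.
  tensorLift _ (isKBilinear_uncurry (ofModuleLift (A := internalHom (ofModule N) A)
    { toFun := fun m => (internalHomEquiv _ _).symm (ofModuleLift (g m))
      map_add' := fun m m' => homMod_ext <| by
        intro x
        obtain ⟨n, rfl⟩ := toReflect_surjective _ x
        exact LinearMap.congr_fun (map_add g m m') n
      map_smul' := fun q m => homMod_ext <| by
        intro x
        obtain ⟨n, rfl⟩ := toReflect_surjective _ x
        exact LinearMap.congr_fun (map_smul g q m) n }))

variable (M N) in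
/-- The multiplication isomorphism of `ofModuleFunctor`. -/
def ofModuleMulIso :
    tensor (ofModule M) (ofModule N) ≅ ofModule (ModuleCat.of Q (TensorProduct Q M N)) where
  hom := ofModuleLift₂ ((TensorProduct.mk Q M N).compr₂ (toOfModule (.of Q (TensorProduct Q M N))))
  inv := ofModuleLift (TensorProduct.lift (LinearMap.mk₂ Q
    (fun m n => tensorMk (toOfModule M m) (toOfModule N n))
    (fun m m' n => by rw [map_add, isKBilinear_tensorMk.map_add_left])
    (fun q m n => by rw [map_smul, isKBilinear_tensorMk.map_smul_left])
    (fun m n n' => by rw [map_add, isKBilinear_tensorMk.map_add_right])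
    (fun q m n => by rw [map_smul, isKBilinear_tensorMk.map_smul_right])))
  hom_inv_id := tensor_ofModule_hom_ext fun _ _ => rfl
  inv_hom_id := ofModule_tensor_hom_ext fun _ _ => rfl

variable [IsKRing Q]

attribute [local instance] monoidalCategory symmetricCategory

variable (Q) in
/-- The unit isomorphism of `ofModuleFunctor`. -/
def ofModuleUnitIso : self Q ≅ ofModule (ModuleCat.of Q Q) where
  hom := ofElement (toOfModule (ModuleCat.of Q Q) (1 : Q))
  inv := ofModuleLift (A := self Q) (LinearMap.id (R := Q) (M := Q))
  hom_inv_id := unit_hom_ext <| one_smul Q (1 : Q)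
  inv_hom_id := ofModule_hom_ext fun q =>
    (map_smul (toOfModule (ModuleCat.of Q Q)) (show Q from q) (1 : Q)).symm.trans
      (congrArg (toOfModule (ModuleCat.of Q Q)) (mul_one (show Q from q)))

theorem ofModuleMulIso_hom_unit_left (m : M) :
    (ofModuleMulIso (ModuleCat.of Q Q) M).hom
      (tensorMk ((ofModuleUnitIso Q).hom (show self Q from (1 : Q))) (toOfModule M m)) =
      toOfModule (ModuleCat.of Q (TensorProduct Q Q M)) (1 ⊗ₜ m) := by
  rw [show (ofModuleUnitIso Q).hom (show self Q from (1 : Q)) =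
    toOfModule (ModuleCat.of Q Q) (1 : Q) from ofElement_one _]
  rfl

theorem ofModuleMulIso_hom_unit_right (m : M) :
    (ofModuleMulIso M (ModuleCat.of Q Q)).hom
      (tensorMk (toOfModule M m) ((ofModuleUnitIso Q).hom (show self Q from (1 : Q)))) =
      toOfModule (ModuleCat.of Q (TensorProduct Q M Q)) (m ⊗ₜ 1) := by
  rw [show (ofModuleUnitIso Q).hom (show self Q from (1 : Q)) =
    toOfModule (ModuleCat.of Q Q) (1 : Q) from ofElement_one _]
  rfl

variable (Q) in
/-- The functor `ofModuleFunctor` is strong monoidal. -/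
def ofModuleCoreMonoidal : (ofModuleFunctor.{u} Q).CoreMonoidal where
  εIso := ofModuleUnitIso Q
  μIso M N := ofModuleMulIso M N
  μIso_hom_natural_left _ _ := tensor_ofModule_hom_ext fun _ _ => rfl
  μIso_hom_natural_right _ _ := tensor_ofModule_hom_ext fun _ _ => rfl
  associativity M N P := tensor_ofModule_hom_ext₃ fun m n p => congrArg (toOfModule _)
    (ModuleCat.MonoidalCategory.associator_hom_apply (M := M) (N := N) (K := P) m n p)
  left_unitality M := (cancel_epi (tensorUnitLeft (ofModule M)).inv).mp <|
    ofModule_hom_ext fun m => (one_smul Q (toOfModule M m)).trans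
      ((congrArg ((ofModuleFunctor Q).map (λ_ M).hom) (ofModuleMulIso_hom_unit_left m)).trans
        (congrArg (toOfModule M) ((ModuleCat.MonoidalCategory.leftUnitor_hom_apply
          (1 : Q) m).trans (one_smul Q m)))).symm
  right_unitality M := (cancel_epi
    ((tensorUnitLeft (ofModule M)).symm ≪≫ tensorSwap _ _).hom).mp <|
    ofModule_hom_ext fun m => (one_smul Q (toOfModule M m)).trans
      ((congrArg ((ofModuleFunctor Q).map (ρ_ M).hom) (ofModuleMulIso_hom_unit_right m)).trans
        (congrArg (toOfModule M) ((ModuleCat.MonoidalCategory.rightUnitor_hom_apply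
          m (1 : Q)).trans (one_smul Q m)))).symm

end OfModule

end KMod

end

noncomputable section

namespace KMod

variable {Q R : Type u} [CommRing Q] [TopologicalSpace Q] [Ring R] [TopologicalSpace R]
  [Algebra Q R] {hQR : Continuous (algebraMap Q R)}

/-! ### The enrichment -/

section Enrichment

variable {A B C D : KMod.{u} R}

/-- After uncurrying, continuity is that of the iterated evaluation `k (h a)`. Linearity in `h` is
linearity of the morphism `k`. -/
theorem isKBilinear_comp : IsKBilinear fun (h : homMod hQR A B) (k : homMod hQR B C) =>
    (homModEquiv hQR A C).symm (homModEquiv hQR A B h ≫ homModEquiv hQR B C k) where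
  map_add_left _ _ k := homMod_ext fun _ => map_add (toLin (homModEquiv hQR B C k)) _ _
  map_add_right _ _ _ := rfl
  map_smul_left _ _ k := homMod_ext fun _ => map_smul (toLin (homModEquiv hQR B C k)) _ _
  map_smul_right _ _ _ := rfl
  continuous := kContinuous₂_iff.mpr fun _ a b => continuous_homMod_iff.mpr <|
    kContinuous₂_iff.mpr fun _ v c => (kContinuous₂_homModEquiv B C).comp
      (b.continuous.comp v.continuous)
      ((kContinuous₂_homModEquiv A B).comp (a.continuous.comp v.continuous) c.continuous)

variable [IsKRing Q]

attribute [local instance] monoidalCategory symmetricCategory monoidalClosed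

variable (hQR) in
/-- The enrichment of the category of `R`-`k`-modules over `Q`-`k`-modules. -/
@[reducible]
def enrichedCategory : EnrichedCategory (KMod.{u} Q) (KMod.{u} R) where
  Hom A B := homMod hQR A B
  id A := ofElement ((homModEquiv hQR A A).symm (𝟙 A))
  comp _ _ _ := tensorLift _ isKBilinear_comp
  -- Moving the unitor across gives two maps out of `Q ⊗ Hom`, which are compared on `1 ⊗ h`.
  id_comp A _ := (Iso.inv_comp_eq _).mpr <| unit_tensor_hom_ext fun h =>
    (congrArg (fun k => tensorLift _ isKBilinear_comp (tensorMk k h))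
      (ofElement_one ((homModEquiv hQR A A).symm (𝟙 A)))).trans (one_smul Q h).symm
  comp_id _ B := (Iso.inv_comp_eq _).mpr <| tensor_unit_hom_ext fun h =>
    (congrArg (fun k => tensorLift _ isKBilinear_comp (tensorMk h k))
      (ofElement_one ((homModEquiv hQR B B).symm (𝟙 B)))).trans (one_smul Q h).symm
  assoc _ _ _ _ := (Iso.inv_comp_eq _).mpr <| tensor_hom_ext₃ fun _ _ _ => rfl

variable (hQR) in
/-- The category of `R`-`k`-modules as an ordinary category enriched over `Q`-`k`-modules. -/
@[reducible]
def enrichedOrdinaryCategory : EnrichedOrdinaryCategory (KMod.{u} Q) (KMod.{u} R) where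
  __ := enrichedCategory hQR
  homEquiv {A B} :=
    { toFun := fun f => ofElement ((homModEquiv hQR A B).symm f)
      invFun := fun g => homModEquiv hQR A B (g (show self Q from (1 : Q)))
      left_inv := fun _ => congrArg (homModEquiv hQR A B) (ofElement_one _)
      right_inv := fun _ => unit_hom_ext (ofElement_one _) }
  homEquiv_id _ := rfl
  homEquiv_comp {A B C} f g := (Iso.eq_inv_comp _).mpr <|
    (cancel_epi (tensorUnitLeft (self Q)).inv).mp <| unit_hom_ext <|
      (congrArg (ofElement ((homModEquiv hQR A C).symm (f ≫ g))) (one_smul Q (1 : Q))).trans <|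
        (ofElement_one _).trans <| .symm <|
          congrArg₂ (fun h k => tensorLift _ isKBilinear_comp (tensorMk h k))
            (ofElement_one ((homModEquiv hQR A B).symm f))
            (ofElement_one ((homModEquiv hQR B C).symm g))

end Enrichment

/-! ### Powers -/

section Power

variable {A : KMod.{u} Q} {B X : KMod.{u} R}

/-- Evaluation of an element of the power. -/
def powerApply (f : power (R := R) A B) (a : A) : B := (show powerSubmodule (R := R) A B from f).1 a

theorem power_ext {f g : power (R := R) A B} (h : ∀ a, powerApply f a = powerApply g a) : f = g :=
  Subtype.ext (funext h)

theorem continuous_power_iff {W : Type u} [TopologicalSpace W] [CompactlyGeneratedSpace W]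
    {g : W → power (R := R) A B} :
    Continuous g ↔ KContinuous₂ fun w a => powerApply (g w) a :=
  continuous_funMod_iff _ _

theorem kContinuous₂_powerApply :
    KContinuous₂ fun (f : power (R := R) A B) (a : A) => powerApply f a :=
  continuous_power_iff.mp continuous_id

variable (hQR A B) in
/-- The counit of the power. -/
def powerCounit : A ⟶ homMod hQR (power A B) B :=
  mkHom
    { toFun := fun a => (homModEquiv hQR _ _).symm (mkHom
        ⟨⟨fun f => powerApply f a, fun _ _ => rfl⟩, fun _ _ => rfl⟩
        (kContinuous₂_powerApply.comp continuous_id continuous_const))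
      map_add' := fun a a' => homMod_ext fun f =>
        (show powerSubmodule (R := R) A B from f).2.1 a a'
      map_smul' := fun q a => homMod_ext fun f =>
        (show powerSubmodule (R := R) A B from f).2.2.1 q a }
    (continuous_homMod_iff.mpr kContinuous₂_powerApply.swap)

/-- Continuity of double evaluation, the analytic input for the inverses of both the power and the
copower comparison. -/
theorem kContinuous₃_hom (K : CompHaus.{u}) {h : K → internalHom A (homMod hQR X B)} {a : K → A}
    {x : K → X} (hh : Continuous h) (ha : Continuous a) (hx : Continuous x) :
    Continuous fun k =>
      homModEquiv hQR X B (internalHomEquiv A (homMod hQR X B) (h k) (a k)) (x k) :=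
  (kContinuous₂_homModEquiv X B).comp
    ((kContinuous₂_homModEquiv (hQR := continuous_id) A (homMod hQR X B)).comp hh ha) hx

/-- The morphism to the power given by a morphism to a `k`-module of morphisms. -/
def powerLift (h : A ⟶ homMod hQR X B) : X ⟶ power A B :=
  mkHom
    { toFun := fun x => show powerSubmodule (R := R) A B from
        ⟨fun a => homModEquiv hQR X B (h a) x,
          fun a a' => congrArg (fun k => homModEquiv hQR X B k x) (map_add (toLin h) a a'),
          fun q a => congrArg (fun k => homModEquiv hQR X B k x) (map_smul (toLin h) q a),
          (kContinuous₂_homModEquiv X B).comp (continuous_hom h) continuous_const⟩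
      map_add' := fun x x' => power_ext fun a => map_add (toLin (homModEquiv hQR X B (h a))) x x'
      map_smul' := fun r x => power_ext fun a =>
        map_smul (toLin (homModEquiv hQR X B (h a))) r x }
    (continuous_power_iff.mpr
      ((kContinuous₂_homModEquiv X B).comp₂ (continuous_hom h) continuous_id continuous_id).swap)

variable [IsKRing Q]

attribute [local instance] monoidalCategory symmetricCategory monoidalClosed

theorem powered (hQR : Continuous (algebraMap Q R)) :
    letI := enrichedOrdinaryCategory hQR
    EnrichedPower.Powered (KMod.{u} Q) (KMod.{u} R) := by
  let := enrichedOrdinaryCategory hQR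
  intro A B
  refine ⟨power A B, powerCounit hQR A B, fun X => ?_⟩
  -- Algebraically, comparison and inverse only exchange the arguments `a` and `x`. What has to be
  -- proved is continuity of the inverse, reduced to double evaluation by two uses of the
  -- exponential law.
  exact (isoOfInverse (EnrichedPower.powerComparison (powerCounit hQR A B) X)
    (fun h => (homModEquiv hQR X (power A B)).symm (powerLift (internalHomEquiv A _ h)))
    (continuous_homMod_iff.mpr <| kContinuous₂_iff.mpr fun K h x =>
      continuous_power_iff.mpr <| kContinuous₂_iff.mpr fun L v a =>
        kContinuous₃_hom L (h.continuous.comp v.continuous) a.continuous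
          (x.continuous.comp v.continuous))
    (fun _ => rfl) (fun _ => rfl)).isIso_hom

end Power

/-! ### Copowers -/

section Copower

variable (hQR) (A : KMod.{u} Q) (B : KMod.{u} R)

/-- The `R`-module structure on the abstract tensor product underlying the copower. -/
@[reducible]
def copowerModule : Module R (TensorProduct Q (restrict hQR B) A) :=
  letI : Module R (restrict hQR B) := B.module
  -- Since the actions of `Q` and `R` on `B` commute, `R` acts through the left factor.
  haveI : SMulCommClass Q R (restrict hQR B) := ⟨fun q r b => smul_algebraMap_comm B q r b⟩
  TensorProduct.leftModule

attribute [local instance] copowerModule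

theorem span_range_copowerGen :
    Submodule.span R (Set.range (tensorGen (restrict hQR B) A)) = ⊤ := by
  refine Submodule.eq_top_iff'.mpr fun x => ?_
  induction x using TensorProduct.induction_on with
  | zero => exact zero_mem _
  | tmul b a => exact Submodule.subset_span ⟨(b, a), rfl⟩
  | add x y hx hy => exact add_mem hx hy

/-- The copower of an `R`-`k`-module by a `Q`-`k`-module. -/
def copower : KMod.{u} R := reflect R (tensorGen (restrict hQR B) A)

variable {A B}

/-- The elementary tensors in the copower. -/
def copowerMk (b : B) (a : A) : copower hQR A B :=
  toReflect R (tensorGen (restrict hQR B) A) ((show restrict hQR B from b) ⊗ₜ a)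

theorem kContinuous₂_copowerMk :
    KContinuous₂ fun (b : B) (a : A) => copowerMk hQR b a :=
  continuous_toReflect (tensorGen (restrict hQR B) A)

variable (A B) in
/-- The unit of the copower. -/
def copowerUnit : A ⟶ homMod hQR B (copower hQR A B) :=
  mkHom
    { toFun := fun a => (homModEquiv hQR _ _).symm (mkHom
        { toFun := fun b => copowerMk hQR b a
          map_add' := fun b b' => (congrArg (toReflect R _)
            (TensorProduct.add_tmul (show restrict hQR B from b) b' a)).trans (map_add _ _ _)
          map_smul' := fun r b => map_smul (toReflect R (tensorGen (restrict hQR B) A)) r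
            ((show restrict hQR B from b) ⊗ₜ a) }
        ((kContinuous₂_copowerMk hQR).comp continuous_id continuous_const))
      map_add' := fun a a' => homMod_ext fun b => (congrArg (toReflect R _)
        (TensorProduct.tmul_add (show restrict hQR B from b) a a')).trans (map_add _ _ _)
      -- The scalar `q` crosses the tensor sign to `b`, where it acts as `algebraMap Q R q`.
      map_smul' := fun q a => homMod_ext fun b => (congrArg (toReflect R _)
        (TensorProduct.smul_tmul q (show restrict hQR B from b) a).symm).trans
          (map_smul (toReflect R (tensorGen (restrict hQR B) A)) (algebraMap Q R q)
            ((show restrict hQR B from b) ⊗ₜ a)) }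
    (continuous_homMod_iff.mpr (kContinuous₂_copowerMk hQR).swap)

variable {hQR} {X : KMod.{u} R}

/-- The linear map out of the abstract copower given by a morphism to a module of morphisms. -/
def copowerLinear (h : A ⟶ homMod hQR B X) : TensorProduct Q (restrict hQR B) A →ₗ[R] X :=
  let φ : TensorProduct Q (restrict hQR B) A →ₗ[Q] restrict hQR X :=
    TensorProduct.lift (LinearMap.mk₂ Q
      (fun b a => show restrict hQR X from homModEquiv hQR B X (h a) b)
      (fun b b' a => map_add (toLin (homModEquiv hQR B X (h a))) b b')
      (fun q b a => map_smul (toLin (homModEquiv hQR B X (h a))) (algebraMap Q R q) (show B from b))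
      (fun b a a' => congrArg (fun k => homModEquiv hQR B X k b) (map_add (toLin h) a a'))
      (fun q b a => congrArg (fun k => homModEquiv hQR B X k b) (map_smul (toLin h) q a)))
  { toFun := φ
    map_add' := map_add φ
    map_smul' := fun r x => by
      induction x using TensorProduct.induction_on with
      | zero => exact (congrArg φ (smul_zero r)).trans ((map_zero φ).trans (smul_zero (A := X) r).symm)
      | tmul b a => exact map_smul (toLin (homModEquiv hQR B X (h a))) r (show B from b)
      | add x y hx hy =>
        exact (congrArg φ (smul_add r x y)).trans <| (map_add φ _ _).trans <|
          (congrArg₂ (· + ·) hx hy).trans <| ((congrArg (fun z : X => r • z) (map_add φ x y)).trans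
            (smul_add (A := X) r _ _)).symm }

/-- The morphism out of the copower given by a morphism to a `k`-module of morphisms. -/
def copowerLift (h : A ⟶ homMod hQR B X) : copower hQR A B ⟶ X :=
  reflectLift (copowerLinear h)
    ((kContinuous₂_homModEquiv B X).comp₂ (continuous_hom h) continuous_id continuous_id).swap

variable [IsKRing Q]

attribute [local instance] monoidalCategory symmetricCategory monoidalClosed

theorem copowered (hQR : Continuous (algebraMap Q R)) :
    letI := enrichedOrdinaryCategory hQR
    EnrichedPower.Copowered (KMod.{u} Q) (KMod.{u} R) := by
  let := enrichedOrdinaryCategory hQR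
  intro A B
  refine ⟨copower hQR A B, copowerUnit hQR A B, fun X => ?_⟩
  exact (isoOfInverse (EnrichedPower.copowerComparison (copowerUnit hQR A B) X)
    (fun h => (homModEquiv hQR (copower hQR A B) X).symm (copowerLift (internalHomEquiv A _ h)))
    -- The parametrized universal property reduces continuity of the inverse to elementary tensors
    -- `b ⊗ a`, where it is double evaluation.
    (continuous_homMod_iff.mpr <| kContinuous₂_reflect (span_range_copowerGen hQR A B) _ <|
      kContinuous₂_iff.mpr fun K h p =>
        kContinuous₃_hom K h.continuous
          ((KSpace.prodSnd ⟨B⟩ ⟨A⟩ : C(KSpace.prod ⟨B⟩ ⟨A⟩, A)).continuous.comp p.continuous)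
          ((KSpace.prodFst ⟨B⟩ ⟨A⟩ : C(KSpace.prod ⟨B⟩ ⟨A⟩, B)).continuous.comp p.continuous))
    (fun f => (homModEquiv hQR (copower hQR A B) X).injective <|
      reflect_hom_ext (span_range_copowerGen hQR A B) fun _ => rfl)
    (fun _ => rfl)).isIso_hom

end Copower

end KMod

end

/-! ### Assembly of the three statements -/

theorem mainTheorem12 (Q : Type u) [CommRing Q] [TopologicalSpace Q] [IsKRing Q]
    (R : Type u) [Ring R] [TopologicalSpace R] [IsKRing R] [Algebra Q R]
    (hQR : Continuous (algebraMap Q R)) :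
    -- (i) a symmetric monoidal closed structure given by the tensor product over `Q`
    ∃ (_ : MonoidalCategory (KMod.{u} Q)) (_ : SymmetricCategory (KMod.{u} Q))
      (_ : MonoidalClosed (KMod.{u} Q)) (T : KMod.TensorStructure Q),
      (∀ A B : KMod.{u} Q, ∃ e : ((ihom A).obj B : KMod.{u} Q) ≃ (A ⟶ B),
        KMod.IsHomModule e ∧
        ∀ (a : A) (h : ((ihom A).obj B : KMod.{u} Q)),
          (ihom.ev A).app B (T.tmul a h) = e h a) ∧
      -- (ii) the strong monoidal left adjoints
      (∃ (F : KSpace.{u} ⥤ KMod.{u} Q) (_ : F.Monoidal) (adj : F ⊣ KMod.forgetToKSpace Q),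
        (∀ x : (𝟙_ KSpace.{u} : KSpace.{u}),
          Functor.LaxMonoidal.ε F T.one = adj.unit.app (𝟙_ KSpace.{u}) x) ∧
        (∀ (X Y : KSpace.{u}) (z : (X ⊗ Y : KSpace.{u})),
          Functor.LaxMonoidal.μ F X Y
            (T.tmul (A := F.obj X) (B := F.obj Y)
              (adj.unit.app X (CartesianMonoidalCategory.fst X Y z))
              (adj.unit.app Y (CartesianMonoidalCategory.snd X Y z))) =
            adj.unit.app (X ⊗ Y) z)) ∧
      (∃ (G : ModuleCat.{u} Q ⥤ KMod.{u} Q) (_ : G.Monoidal)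
          (adj : G ⊣ KMod.forgetToModuleCat Q),
        (Functor.LaxMonoidal.ε G T.one =
          adj.unit.app (𝟙_ (ModuleCat.{u} Q)) (1 : Q)) ∧
        (∀ (A B : ModuleCat.{u} Q) (a : A) (b : B),
          Functor.LaxMonoidal.μ G A B
            (T.tmul (A := G.obj A) (B := G.obj B) (adj.unit.app A a) (adj.unit.app B b)) =
            adj.unit.app (A ⊗ B) (a ⊗ₜ[Q] b))) ∧
      -- (iii) the enrichment, with powers and copowers
      (∃ _ : EnrichedOrdinaryCategory (KMod.{u} Q) (KMod.{u} R),
        (∃ e : ∀ A B : KMod.{u} R, (EnrichedCategory.Hom A B : KMod.{u} Q) ≃ (A ⟶ B),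
          (∀ A B, KMod.IsHomModule (e A B)) ∧
          (∀ (A B : KMod.{u} R) (f : A ⟶ B), e A B (eHomEquiv (KMod.{u} Q) f T.one) = f) ∧
          (∀ (A B C : KMod.{u} R) (h : (EnrichedCategory.Hom A B : KMod.{u} Q))
            (k : (EnrichedCategory.Hom B C : KMod.{u} Q)),
            e A C (eComp (KMod.{u} Q) A B C (T.tmul h k)) = e A B h ≫ e B C k)) ∧
        EnrichedPower.Powered (KMod.{u} Q) (KMod.{u} R) ∧
        EnrichedPower.Copowered (KMod.{u} Q) (KMod.{u} R)) := by
  let := KMod.monoidalCategory Q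
  let := KMod.symmetricCategory Q
  let := KMod.monoidalClosed Q
  let := (KMod.freeCoreMonoidal Q).toMonoidal
  let := (KMod.ofModuleCoreMonoidal Q).toMonoidal
  let := KMod.enrichedOrdinaryCategory hQR
  refine ⟨KMod.monoidalCategory Q, KMod.symmetricCategory Q, KMod.monoidalClosed Q,
    KMod.tensorStructure Q, fun A B => ⟨KMod.internalHomEquiv A B,
      KMod.isHomModule_homModEquiv A B, KMod.ev_tensorMk A B⟩,
    ⟨KMod.freeFunctor Q, inferInstance, KMod.freeAdjunction Q,
      fun _ => KMod.freeUnitIso_hom_one, fun X Y z => ?_⟩,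
    ⟨KMod.ofModuleFunctor Q, inferInstance, KMod.ofModuleAdjunction Q,
      KMod.ofElement_one _, fun A B a b => ?_⟩,
    KMod.enrichedOrdinaryCategory hQR, ⟨KMod.homModEquiv hQR,
      KMod.isHomModule_homModEquiv, fun A B f => ?_, fun A B C h k => ?_⟩,
    KMod.powered hQR, KMod.copowered hQR⟩
  · exact KMod.freeMulIso_hom_toFree _ _
  · rfl
  · exact congrArg (KMod.homModEquiv hQR A B) (KMod.ofElement_one _)
  · rfl
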